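/- Manifolds are finite-dimensional, Hausdorff and smooth. A symplectic principal $\mathbb R$-bundle $\mu:(A,\Omega)\to V$ is a principal $\mathbb R$-bundle $\mu:A\to V$ with a symplectic form $\Omega$ on $A$ which is invariant under the principal action $\psi:\mathbb R\times A\to A$. The manifold $A$ carries the Poisson bracket $\{F,G\}_A=\Omega(\mathcal H_F,\mathcal H_G)$, where $i_{\mathcal H_F}\Omega=dF$. For a Poisson structure $\Lambda$ on a manifold $M$, $\sharp_\Lambda:T^*M\to TM$ is defined by $\beta(\sharp_\Lambda\alpha)=\Lambda(\alpha,\beta)$, and $W^\circ$ denotes the annihilator of a subspace $W$ of a tangent space. **Proposition.** Let $\mu:(A,\Omega)\to V$ and $\mu':(A',\Omega')\to V'$ be symplectic principal $\mathbb R$-bundles, with principal actions $\psi$ and $\psi'$, and let $\varphi:A\to A'$ be an embedding of symplectic principal $\mathbb R$-bundles, that is, a smooth embedding with $\varphi\circ\psi_s=\psi'_s\circ\varphi$ for all $s\in\mathbb R$ and $\varphi^*\Omega'=\Omega$. Let $\varphi^V:V\to V'$ be the induced map, characterized by $\mu'\circ\varphi=\varphi^V\circ\mu$. 1. There are unique Poisson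 structures $\Lambda_V$ on $V$ and $\Lambda_{V'}$ on $V'$ for which $\mu$ and $\mu'$ are Poisson maps (the induced Poisson structures), and $\varphi^V$ is a smooth embedding. 2. For every $v\in V$, identifying $T_vV$ with its image in $T_{\varphi^V(v)}V'$ under $T_v\varphi^V$, $$T^*_{\varphi^V(v)}V'=(T_vV)^\circ\oplus\big(\sharp_{\Lambda_{V'}}(T_vV)^\circ\big)^\circ .$$ If $\widetilde q_v:T^*_{\varphi^V(v)}V'\to(T_vV)^\circ$ is the first projector of this splitting, then for all $\sigma_1,\sigma_2\in T^*_{\varphi^V(v)}V'$ $$\Lambda_V(v)\big((\varphi^V)^*\sigma_1,(\varphi^V)^*\sigma_2\big)=\Lambda_{V'}(\varphi^V(v))(\sigma_1,\sigma_2)-\Lambda_{V'}(\varphi^V(v))\big(\widetilde q_v\sigma_1,\widetilde q_v\sigma_2\big).$$ 3. If $\varphi$ is an isomorphism (that is, if moreover $\varphi$ is a diffeomorphism), then $\varphi^V$ is a Poisson isomorphism: a diffeomorphism such that $\varphi^V$ and its inverse are Poisson maps. -/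

import Mathlib

open scoped Manifold ContDiff

noncomputable section

namespace SymplecticR

/-! Throughout, a manifold modelled on the finite-dimensional real vector space `E` is a
charted space over `E` with its smooth structure (no boundary). -/

section Manifolds

variable {E : Type*} [NormedAddCommGroup E] [NormedSpace ℝ E]
  {M : Type*} [TopologicalSpace M] [ChartedSpace E M]
  {E' : Type*} [NormedAddCommGroup E'] [NormedSpace ℝ E']
  {M' : Type*} [TopologicalSpace M'] [ChartedSpace E' M']

instance instFiniteDimensionalTangentSpace [FiniteDimensional ℝ E] (x : M) :
    FiniteDimensional ℝ (TangentSpace 𝓘(ℝ, E) x) :=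
  inferInstanceAs (FiniteDimensional ℝ E)

variable (E) in
/-- The cotangent space `T*_x M`. -/
abbrev Cotangent (x : M) : Type _ := Module.Dual ℝ (TangentSpace 𝓘(ℝ, E) x)

variable (E) in
/-- The differential `df(x) ∈ T*_x M` of a real function. -/
def differential (f : M → ℝ) (x : M) : Cotangent E x :=
  (mvfderiv 𝓘(ℝ, E) f x : TangentSpace 𝓘(ℝ, E) x →ₗ[ℝ] ℝ)

variable (E E') in
/-- The tangent map `T_x φ : T_x M → T_{φ x} M'`. -/
def tangent (φ : M → M') (x : M) :
    TangentSpace 𝓘(ℝ, E) x →ₗ[ℝ] TangentSpace 𝓘(ℝ, E') (φ x) :=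
  (mfderiv 𝓘(ℝ, E) 𝓘(ℝ, E') φ x :
    TangentSpace 𝓘(ℝ, E) x →ₗ[ℝ] TangentSpace 𝓘(ℝ, E') (φ x))

variable (E E') in
/-- A smooth embedding: a smooth map which is a homeomorphism onto its image and whose
tangent maps are all injective. -/
structure IsManifoldEmbedding (φ : M → M') : Prop where
  contMDiff : ContMDiff 𝓘(ℝ, E) 𝓘(ℝ, E') ∞ φ
  isEmbedding : Topology.IsEmbedding φ
  tangent_injective : ∀ x, Function.Injective (tangent E E' φ x)

/-! ### Bivector fields and Poisson structures -/

variable (E M) in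
/-- A field of bilinear forms on the cotangent spaces (skew-symmetry and smoothness are part of
`IsPoisson` below). -/
abbrev Bivector : Type _ := ∀ x : M, Cotangent E x →ₗ[ℝ] Cotangent E x →ₗ[ℝ] ℝ

/-- The bracket `{f, g} = Λ(df, dg)`. -/
def Bivector.bracket (Λ : Bivector E M) (f g : M → ℝ) (x : M) : ℝ :=
  Λ x (differential E f x) (differential E g x)

/-- `♯_Λ : T*_x M → T_x M`, determined by `β (♯_Λ α) = Λ(α, β)`. -/
def Bivector.sharp [FiniteDimensional ℝ E] (Λ : Bivector E M) (x : M) :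
    Cotangent E x →ₗ[ℝ] TangentSpace 𝓘(ℝ, E) x :=
  (Module.evalEquiv ℝ (TangentSpace 𝓘(ℝ, E) x)).symm.toLinearMap ∘ₗ Λ x

/-- `Λ` is a Poisson structure: it is skew-symmetric, it is smooth (brackets of smooth functions
are smooth), and its bracket satisfies the Jacobi identity. -/
structure IsPoisson (Λ : Bivector E M) : Prop where
  alt : ∀ x α, Λ x α α = 0
  smooth : ∀ f g : M → ℝ, ContMDiff 𝓘(ℝ, E) 𝓘(ℝ, ℝ) ∞ f → ContMDiff 𝓘(ℝ, E) 𝓘(ℝ, ℝ) ∞ g →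
    ContMDiff 𝓘(ℝ, E) 𝓘(ℝ, ℝ) ∞ (Λ.bracket f g)
  jacobi : ∀ f g h : M → ℝ, ContMDiff 𝓘(ℝ, E) 𝓘(ℝ, ℝ) ∞ f → ContMDiff 𝓘(ℝ, E) 𝓘(ℝ, ℝ) ∞ g →
    ContMDiff 𝓘(ℝ, E) 𝓘(ℝ, ℝ) ∞ h → ∀ x,
    Λ.bracket f (Λ.bracket g h) x + Λ.bracket g (Λ.bracket h f) x
      + Λ.bracket h (Λ.bracket f g) x = 0

/-- `φ` is a Poisson map from `(M, Λ)` to `(M', Λ')`: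
`{f ∘ φ, g ∘ φ} = {f, g}' ∘ φ` for all smooth functions `f, g` on `M'`. -/
structure IsPoissonMap (Λ : Bivector E M) (Λ' : Bivector E' M') (φ : M → M') : Prop where
  contMDiff : ContMDiff 𝓘(ℝ, E) 𝓘(ℝ, E') ∞ φ
  bracket_comp : ∀ f g : M' → ℝ,
    ContMDiff 𝓘(ℝ, E') 𝓘(ℝ, ℝ) ∞ f → ContMDiff 𝓘(ℝ, E') 𝓘(ℝ, ℝ) ∞ g →
    ∀ x, Λ.bracket (f ∘ φ) (g ∘ φ) x = Λ'.bracket f g (φ x)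

/-- `φ` is a Poisson isomorphism: a diffeomorphism such that `φ` and its inverse are both
Poisson maps. -/
def IsPoissonIso (Λ : Bivector E M) (Λ' : Bivector E' M') (φ : M → M') : Prop :=
  ∃ Φ : Diffeomorph 𝓘(ℝ, E) 𝓘(ℝ, E') M M' ∞,
    ⇑Φ = φ ∧ IsPoissonMap Λ Λ' Φ ∧ IsPoissonMap Λ' Λ Φ.symm

/-! ### Symplectic forms -/

/-- The expression of a 2-form in the preferred chart around `x₀`: its pullback by the inverse of
the chart, which is a 2-form on the target of the chart. -/
def localForm (η : ∀ x : M, TangentSpace 𝓘(ℝ, E) x [⋀^Fin 2]→L[ℝ] ℝ) (x₀ : M) (y : E) :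
    E [⋀^Fin 2]→L[ℝ] ℝ :=
  (η ((extChartAt 𝓘(ℝ, E) x₀).symm y)).compContinuousLinearMap
    ((mfderiv 𝓘(ℝ, E) 𝓘(ℝ, E) (extChartAt 𝓘(ℝ, E) x₀).symm y).comp
      (NormedSpace.fromTangentSpace (𝕜 := ℝ) y).symm.toContinuousLinearMap)

variable (E M) in
/-- A symplectic form on `M`: a smooth, closed, nondegenerate 2-form. -/
structure SymplecticForm where
  /-- the underlying 2-form -/
  form : ∀ x : M, TangentSpace 𝓘(ℝ, E) x [⋀^Fin 2]→L[ℝ] ℝ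
  smooth : ∀ x₀ : M, ContDiffOn ℝ ∞ (localForm form x₀) (extChartAt 𝓘(ℝ, E) x₀).target
  closed : ∀ x₀ : M, ∀ y ∈ (extChartAt 𝓘(ℝ, E) x₀).target,
    extDeriv (localForm form x₀) y = 0
  nondegenerate : ∀ (x : M) (u : TangentSpace 𝓘(ℝ, E) x),
    (∀ w, form x ![u, w] = 0) → u = 0

/-- The pullback of a 2-form by a map. -/
def pullbackForm (φ : M → M') (η : ∀ x : M', TangentSpace 𝓘(ℝ, E') x [⋀^Fin 2]→L[ℝ] ℝ) (x : M) :
    TangentSpace 𝓘(ℝ, E) x [⋀^Fin 2]→L[ℝ] ℝ :=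
  (η (φ x)).compContinuousLinearMap (mfderiv 𝓘(ℝ, E) 𝓘(ℝ, E') φ x)

/-- A symplectic form at a point, as a bilinear form. -/
def SymplecticForm.bilin (Ω : SymplecticForm E M) (x : M) :
    LinearMap.BilinForm ℝ (TangentSpace 𝓘(ℝ, E) x) :=
  LinearMap.mk₂ ℝ (fun u w => Ω.form x ![u, w])
    (fun u u' w => (Ω.form x).toMultilinearMap.cons_add ![w] u u')
    (fun c u w => (Ω.form x).toMultilinearMap.cons_smul ![w] c u)
    (fun u w w' => by
      have e : ∀ z, Function.update ![u, w] 1 z = ![u, z] := fun z => by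
        ext i; fin_cases i <;> rfl
      have h := (Ω.form x).map_update_add ![u, w] 1 w w'
      rwa [e, e, e] at h)
    (fun c u w => by
      have e : ∀ z, Function.update ![u, w] 1 z = ![u, z] := fun z => by
        ext i; fin_cases i <;> rfl
      have h := (Ω.form x).map_update_smul ![u, w] 1 c w
      rwa [e, e] at h)

theorem SymplecticForm.bilin_nondegenerate [FiniteDimensional ℝ E] (Ω : SymplecticForm E M)
    (x : M) : (Ω.bilin x).Nondegenerate :=
  LinearMap.BilinForm.Nondegenerate.ofSeparatingLeft (fun u hu => Ω.nondegenerate x u hu)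

/-- The isomorphism `♭ : T_x M → T*_x M`, `u ↦ Ω(u, ·)`. -/
def SymplecticForm.flat [FiniteDimensional ℝ E] (Ω : SymplecticForm E M) (x : M) :
    TangentSpace 𝓘(ℝ, E) x ≃ₗ[ℝ] Cotangent E x :=
  (Ω.bilin x).toDual (Ω.bilin_nondegenerate x)

/-- The Poisson structure of a symplectic manifold: `Λ(α, β) = Ω(♭⁻¹ α, ♭⁻¹ β)`, so that
`{f, g} = Ω(H_f, H_g)` for the Hamiltonian vector fields defined by `Ω(H_f, ·) = df`. -/
def SymplecticForm.poisson [FiniteDimensional ℝ E] (Ω : SymplecticForm E M) : Bivector E M :=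
  fun x => (Ω.bilin x).compl₁₂ (Ω.flat x).symm.toLinearMap (Ω.flat x).symm.toLinearMap

end Manifolds

/-! ### Symplectic principal `ℝ`-bundles -/

/-- A principal `ℝ`-bundle `μ : A → V`, with projection `proj` and principal action `act`
of the Lie group `(ℝ, +)`: around each point of `V` there is a smooth equivariant local
trivialization. -/
structure PrincipalRBundle (EA EV A V : Type*)
    [NormedAddCommGroup EA] [NormedSpace ℝ EA] [NormedAddCommGroup EV] [NormedSpace ℝ EV]
    [TopologicalSpace A] [ChartedSpace EA A] [TopologicalSpace V] [ChartedSpace EV V] where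
  /-- the bundle projection `μ` -/
  proj : A → V
  /-- the principal action `ψ` -/
  act : ℝ → A → A
  contMDiff_proj : ContMDiff 𝓘(ℝ, EA) 𝓘(ℝ, EV) ∞ proj
  contMDiff_act : ContMDiff (𝓘(ℝ, ℝ).prod 𝓘(ℝ, EA)) 𝓘(ℝ, EA) ∞
    (fun p : ℝ × A => act p.1 p.2)
  act_zero : ∀ a, act 0 a = a
  act_add : ∀ s t a, act (s + t) a = act s (act t a)
  proj_act : ∀ s a, proj (act s a) = proj a
  exists_trivialization : ∀ v : V, ∃ e : Bundle.Trivialization ℝ proj, v ∈ e.baseSet ∧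
    ContMDiffOn 𝓘(ℝ, EA) (𝓘(ℝ, EV).prod 𝓘(ℝ, ℝ)) ∞ e e.source ∧
    ContMDiffOn (𝓘(ℝ, EV).prod 𝓘(ℝ, ℝ)) 𝓘(ℝ, EA) ∞ e.toOpenPartialHomeomorph.symm e.target ∧
    ∀ s, ∀ a ∈ e.source, e (act s a) = ((e a).1, (e a).2 + s)

/-- A symplectic principal `ℝ`-bundle `μ : (A, Ω) → V`: a principal `ℝ`-bundle with a symplectic
form on its total space which is preserved by the principal action. -/
structure SymplecticRBundle (EA EV A V : Type*)
    [NormedAddCommGroup EA] [NormedSpace ℝ EA] [NormedAddCommGroup EV] [NormedSpace ℝ EV]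
    [TopologicalSpace A] [ChartedSpace EA A] [TopologicalSpace V] [ChartedSpace EV V]
    extends PrincipalRBundle EA EV A V where
  /-- the symplectic form `Ω` -/
  symp : SymplecticForm EA A
  symplectic_act : ∀ (s : ℝ) (a : A), pullbackForm (act s) symp.form a = symp.form a

section Bundles

variable {EA EV A V : Type*}
  [NormedAddCommGroup EA] [NormedSpace ℝ EA] [NormedAddCommGroup EV] [NormedSpace ℝ EV]
  [TopologicalSpace A] [ChartedSpace EA A] [TopologicalSpace V] [ChartedSpace EV V]
  {EA' EV' A' V' : Type*}
  [NormedAddCommGroup EA'] [NormedSpace ℝ EA'] [NormedAddCommGroup EV'] [NormedSpace ℝ EV']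
  [TopologicalSpace A'] [ChartedSpace EA' A'] [TopologicalSpace V'] [ChartedSpace EV' V']

theorem PrincipalRBundle.proj_surjective (B : PrincipalRBundle EA EV A V) :
    Function.Surjective B.proj := by
  intro v
  obtain ⟨e, hv, -⟩ := B.exists_trivialization v
  exact ⟨e.toOpenPartialHomeomorph.symm (v, 0), e.proj_symm_apply' hv⟩

theorem PrincipalRBundle.exists_act_eq (B : PrincipalRBundle EA EV A V) {a b : A}
    (h : B.proj a = B.proj b) : ∃ s, B.act s a = b := by
  obtain ⟨e, hv, -, -, he⟩ := B.exists_trivialization (B.proj a)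
  have ha : a ∈ e.source := e.mem_source.2 hv
  have hb : b ∈ e.source := e.mem_source.2 (h ▸ hv)
  refine ⟨(e b).2 - (e a).2, ?_⟩
  have hs : B.act ((e b).2 - (e a).2) a ∈ e.source :=
    e.mem_source.2 (by rw [B.proj_act]; exact hv)
  refine e.injOn hs hb (show e _ = e b from ?_)
  rw [he _ a ha]
  refine Prod.ext ?_ (by simp)
  simp [e.coe_fst ha, e.coe_fst hb, h]

/-- The map `φ^V : V → V'` of base spaces induced by a map `φ : A → A'` of total spaces;
for equivariant `φ` it is characterized by `μ' ∘ φ = φ^V ∘ μ`, see `baseMap_proj`. -/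
def baseMap (B : PrincipalRBundle EA EV A V) (B' : PrincipalRBundle EA' EV' A' V')
    (φ : A → A') (v : V) : V' :=
  B'.proj (φ (Function.surjInv B.proj_surjective v))

theorem baseMap_proj (B : PrincipalRBundle EA EV A V) (B' : PrincipalRBundle EA' EV' A' V')
    {φ : A → A'} (hφ : ∀ s a, φ (B.act s a) = B'.act s (φ a)) (a : A) :
    baseMap B B' φ (B.proj a) = B'.proj (φ a) := by
  obtain ⟨s, hs⟩ := B.exists_act_eq (Function.surjInv_eq B.proj_surjective (B.proj a)).symm
  rw [baseMap, ← hs, hφ, B'.proj_act]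

/-- `φ` is an embedding of symplectic principal `ℝ`-bundles: an embedding of the total spaces
which is equivariant and satisfies `φ^* Ω' = Ω`. -/
structure IsSymplecticRBundleEmbedding (B : SymplecticRBundle EA EV A V)
    (B' : SymplecticRBundle EA' EV' A' V') (φ : A → A') : Prop where
  isManifoldEmbedding : IsManifoldEmbedding EA EA' φ
  equivariant : ∀ s a, φ (B.act s a) = B'.act s (φ a)
  pullback : ∀ a, pullbackForm φ B'.symp.form a = B.symp.form a

/-- `Λ` is a Poisson structure on the base space `V` such that `μ : A → V` is a Poisson map,
where `A` carries the Poisson structure of its symplectic form. -/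
def IsInducedPoisson [FiniteDimensional ℝ EA] (B : SymplecticRBundle EA EV A V)
    (Λ : Bivector EV V) : Prop :=
  IsPoisson Λ ∧ IsPoissonMap B.symp.poisson Λ B.proj

end Bundles

/-! ### The splitting of the cotangent spaces along an embedded submanifold -/

section Splitting

variable {E : Type*} [NormedAddCommGroup E] [NormedSpace ℝ E]
  {M : Type*} [TopologicalSpace M] [ChartedSpace E M]
  {E' : Type*} [NormedAddCommGroup E'] [NormedSpace ℝ E']
  {M' : Type*} [TopologicalSpace M'] [ChartedSpace E' M']

variable (E E') in
/-- The annihilator `(T_x M)°` in `T*_{φ x} M'` of the image of `T_x φ`. -/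
def conormal (φ : M → M') (x : M) : Submodule ℝ (Cotangent E' (φ x)) :=
  (LinearMap.range (tangent E E' φ x)).dualAnnihilator

variable (E) in
/-- The annihilator `(♯_{Λ'} (T_x M)°)°` in `T*_{φ x} M'`. -/
def coconormal [FiniteDimensional ℝ E'] (Λ' : Bivector E' M') (φ : M → M') (x : M) :
    Submodule ℝ (Cotangent E' (φ x)) :=
  ((conormal E E' φ x).map (Λ'.sharp (φ x))).dualAnnihilator

end Splitting

end SymplecticR

end

/-! Everything on a base space is computed upstairs. Each `ψ_s` is symplectic, so the form
`Λ_A(μ^*α, μ^*β)` takes the same value at all points of a fibre and descends to `V`. Smoothness and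
Jacobi descend with it, because `μ` has local smooth sections and is surjective. On `A` the Jacobi
identity is the closedness of `Ω`, checked in charts (`localBracket_jacobi`). Uniqueness holds
because every covector on `V` is the differential of a global function (`exists_differential_eq`).

Equivariance of `φ` sends the generator of the action on `A` to that on `A'`, and these generators
span the kernels of `Tμ` and `Tμ'` (`PrincipalRBundle.exists_eq_smul_vertical`). Hence `φ^V` is an
immersion, and `S = Tφ(T_aA)` contains the vertical line of `A'` at `φ(a)`.

Because `φ^*Ω' = Ω`, the subspace `S` is symplectic and `T_{φ(a)}A' = S ⊕ S^⊥`. Covectors on `V'`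
correspond to vectors `u` for which `Ω'(u, ·)` kills the vertical line. As that line lies in `S`,
the `S^⊥`-component of `u` satisfies this condition, hence so does the `S`-component. The
`S^⊥`-components give the conormal space and the `S`-components its `Λ'`-orthogonal complement. On
the latter `Λ'` agrees with `Λ_V`, which is the formula of part 2 (`IsDualForm.splitting`).

For a diffeomorphism, `Tφ` is a symplectic isomorphism and the same comparison upstairs shows that
`φ^V` is Poisson (`isPoissonMap_baseMap`). -/

noncomputable section

namespace SymplecticR

/-! ### Hamiltonian calculus of a closed nondegenerate 2-form on an open set -/

section LocalTheory

variable {E : Type*} [NormedAddCommGroup E] [NormedSpace ℝ E]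

/-- The Hamiltonian vector field of `f` with respect to a field `W` of bilinear forms. -/
def hamiltonianField (W : E → E →L[ℝ] E →L[ℝ] ℝ) (f : E → ℝ) (y : E) : E :=
  (W y).inverse (fderiv ℝ f y)

/-- The Poisson bracket of `f` and `g` with respect to a field `W` of bilinear forms. -/
def localBracket (W : E → E →L[ℝ] E →L[ℝ] ℝ) (f g : E → ℝ) (y : E) : ℝ :=
  W y (hamiltonianField W f y) (hamiltonianField W g y)

variable {W : E → E →L[ℝ] E →L[ℝ] ℝ} {f g h : E → ℝ} {y : E} {U : Set E}

theorem localBracket_congr_right {g' : E → ℝ} (hg : g =ᶠ[nhds y] g') :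
    localBracket W f g y = localBracket W f g' y := by
  rw [localBracket, localBracket, hamiltonianField, hamiltonianField, hamiltonianField,
    hg.fderiv_eq]

/-- `ContinuousLinearMap.inverse` is zero at a non-invertible map, so the defining equation of the
Hamiltonian field depends on invertibility. -/
theorem apply_hamiltonianField (hW : (W y).IsInvertible) :
    W y (hamiltonianField W f y) = fderiv ℝ f y := by
  obtain ⟨e, he⟩ := hW
  simp [hamiltonianField, ← he]

theorem contDiffAt_hamiltonianField [CompleteSpace E] (hW : ContDiffAt ℝ ∞ W y)
    (hi : (W y).IsInvertible) (hf : ContDiffAt ℝ ∞ f y) :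
    ContDiffAt ℝ ∞ (hamiltonianField W f) y :=
  (hi.contDiffAt_map_inverse.comp y hW).clm_apply (hf.fderiv_right (m := ∞) (by simp))

theorem contDiffAt_localBracket [CompleteSpace E] (hW : ContDiffAt ℝ ∞ W y)
    (hi : (W y).IsInvertible) (hf : ContDiffAt ℝ ∞ f y) (hg : ContDiffAt ℝ ∞ g y) :
    ContDiffAt ℝ ∞ (localBracket W f g) y :=
  (hW.clm_apply (contDiffAt_hamiltonianField hW hi hf)).clm_apply
    (contDiffAt_hamiltonianField hW hi hg)

/-- The derivative of the identity `W (H_f, u) = df u` in the direction `w`. -/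
theorem apply_fderiv_hamiltonianField [CompleteSpace E] (hU : IsOpen U) (hy : y ∈ U)
    (hW : ContDiffOn ℝ ∞ W U) (hi : ∀ z ∈ U, (W z).IsInvertible) (hf : ContDiffOn ℝ ∞ f U)
    (w u : E) :
    W y (fderiv ℝ (hamiltonianField W f) y w) u =
      fderiv ℝ (fderiv ℝ f) y w u - fderiv ℝ W y w (hamiltonianField W f y) u := by
  have hUy := hU.mem_nhds hy
  have hWy := hW.contDiffAt hUy
  have hfy := hf.contDiffAt hUy
  have hH := (contDiffAt_hamiltonianField hWy (hi y hy) hfy).differentiableAt (by simp)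
  have hWd := hWy.differentiableAt (by simp)
  have he : (fun z => W z (hamiltonianField W f z)) =ᶠ[nhds y] fderiv ℝ f := by
    filter_upwards [hUy] with z hz using apply_hamiltonianField (hi z hz)
  have h := congrArg (fun T : E →L[ℝ] E →L[ℝ] ℝ => T w u) he.fderiv_eq
  rw [fderiv_clm_apply hWd hH] at h
  simp only [add_apply, ContinuousLinearMap.comp_apply,
    ContinuousLinearMap.flip_apply] at h
  linarith

/-- The product rule gives three terms; skewness and the differentiated identity for `H_f` and `H_g`
eliminate the derivatives of both Hamiltonian fields. Only Hessians and one derivative of `W`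
survive. -/
theorem fderiv_localBracket [CompleteSpace E] (hU : IsOpen U) (hy : y ∈ U)
    (hW : ContDiffOn ℝ ∞ W U) (hi : ∀ z ∈ U, (W z).IsInvertible)
    (hs : ∀ z ∈ U, ∀ u v, W z u v = -W z v u)
    (hf : ContDiffOn ℝ ∞ f U) (hg : ContDiffOn ℝ ∞ g U) (w : E) :
    fderiv ℝ (localBracket W f g) y w =
      fderiv ℝ (fderiv ℝ f) y w (hamiltonianField W g y)
        - fderiv ℝ (fderiv ℝ g) y w (hamiltonianField W f y)
        + fderiv ℝ W y w (hamiltonianField W g y) (hamiltonianField W f y) := by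
  have hUy := hU.mem_nhds hy
  have hWy := hW.contDiffAt hUy
  have hF := (contDiffAt_hamiltonianField hWy (hi y hy) (hf.contDiffAt hUy)).differentiableAt
    (by simp)
  have hG := (contDiffAt_hamiltonianField hWy (hi y hy) (hg.contDiffAt hUy)).differentiableAt
    (by simp)
  have hWd := hWy.differentiableAt (by simp)
  have h1 := apply_fderiv_hamiltonianField hU hy hW hi hf w (hamiltonianField W g y)
  have h2 := apply_fderiv_hamiltonianField hU hy hW hi hg w (hamiltonianField W f y)
  have h3 : fderiv ℝ (localBracket W f g) y w =
      W y (hamiltonianField W f y) (fderiv ℝ (hamiltonianField W g) y w)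
      + (W y (fderiv ℝ (hamiltonianField W f) y w) (hamiltonianField W g y)
      + fderiv ℝ W y w (hamiltonianField W f y) (hamiltonianField W g y)) := by
    have : localBracket W f g =
        fun z => (W z (hamiltonianField W f z)) (hamiltonianField W g z) := rfl
    rw [this, fderiv_clm_apply (hWd.clm_apply hF) hG, fderiv_clm_apply hWd hF]
    simp
  rw [h3, hs y hy (hamiltonianField W f y), h1, h2]
  ring

theorem fderiv_apply_neg_of_skew (hU : IsOpen U) (hy : y ∈ U) (hW : ContDiffOn ℝ ∞ W U)
    (hs : ∀ z ∈ U, ∀ u v, W z u v = -W z v u) (w u v : E) :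
    fderiv ℝ W y w u v = -fderiv ℝ W y w v u := by
  have hUy := hU.mem_nhds hy
  have hWd := (hW.contDiffAt hUy).differentiableAt (by simp)
  have key : ∀ a b : E, fderiv ℝ (fun z => W z a b) y w = fderiv ℝ W y w a b := fun a b => by
    rw [fderiv_clm_apply (hWd.clm_apply (differentiableAt_const a)) (differentiableAt_const b),
      fderiv_clm_apply hWd (differentiableAt_const a)]
    simp
  rw [← key, ← key]
  have he : (fun z => W z u v) =ᶠ[nhds y] fun z => -W z v u := by
    filter_upwards [hUy] with z hz using hs z hz u v
  rw [he.fderiv_eq, fderiv_fun_neg]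
  simp

theorem localBracket_eq_neg_fderiv (hi : (W y).IsInvertible)
    (hs : ∀ u v, W y u v = -W y v u) :
    localBracket W f g y = -fderiv ℝ g y (hamiltonianField W f y) := by
  rw [localBracket, hs, apply_hamiltonianField hi]

/-- The Jacobi identity for the bracket of a closed nondegenerate 2-form on an open set. -/
theorem localBracket_jacobi [CompleteSpace E] (hU : IsOpen U) (hy : y ∈ U)
    (hW : ContDiffOn ℝ ∞ W U) (hi : ∀ z ∈ U, (W z).IsInvertible)
    (hs : ∀ z ∈ U, ∀ u v, W z u v = -W z v u)
    (hc : ∀ u v w, fderiv ℝ W y u v w - fderiv ℝ W y v u w + fderiv ℝ W y w u v = 0)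
    (hf : ContDiffOn ℝ ∞ f U) (hg : ContDiffOn ℝ ∞ g U) (hh : ContDiffOn ℝ ∞ h U) :
    localBracket W f (localBracket W g h) y + localBracket W g (localBracket W h f) y
      + localBracket W h (localBracket W f g) y = 0 := by
  have hsymm : ∀ {k : E → ℝ}, ContDiffOn ℝ ∞ k U → ∀ u v,
      fderiv ℝ (fderiv ℝ k) y u v = fderiv ℝ (fderiv ℝ k) y v u := fun hk u v =>
    ((hk.contDiffAt (hU.mem_nhds hy)).isSymmSndFDerivAt
      (by rw [minSmoothness_of_isRCLikeNormedField]; exact WithTop.coe_le_coe.2 le_top)) u v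
  -- Each outer bracket becomes a derivative of the inner one along a Hamiltonian field. In the
  -- cyclic sum the Hessians cancel in pairs by symmetry, and the derivatives of `W` add up to the
  -- closedness expression `hc`.
  simp only [localBracket_eq_neg_fderiv (hi y hy) (hs y hy)]
  rw [fderiv_localBracket hU hy hW hi hs hg hh, fderiv_localBracket hU hy hW hi hs hh hf,
    fderiv_localBracket hU hy hW hi hs hf hg]
  have h1 := hc (hamiltonianField W f y) (hamiltonianField W g y) (hamiltonianField W h y)
  have h2 := hsymm hf (hamiltonianField W g y) (hamiltonianField W h y)
  have h3 := hsymm hg (hamiltonianField W f y) (hamiltonianField W h y)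
  have h4 := hsymm hh (hamiltonianField W f y) (hamiltonianField W g y)
  have h5 := fderiv_apply_neg_of_skew hU hy hW hs (hamiltonianField W f y)
    (hamiltonianField W g y) (hamiltonianField W h y)
  have h6 := fderiv_apply_neg_of_skew hU hy hW hs (hamiltonianField W h y)
    (hamiltonianField W f y) (hamiltonianField W g y)
  have h7 := fderiv_apply_neg_of_skew hU hy hW hs (hamiltonianField W g y)
    (hamiltonianField W f y) (hamiltonianField W h y)
  linarith

end LocalTheory

/-! ### Linear algebra of dual forms and symplectic subspaces -/

section LinearAlgebra

variable {X X' : Type*} [AddCommGroup X] [Module ℝ X] [AddCommGroup X'] [Module ℝ X']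

/-- `P` is the bilinear form on `X*` dual to the bilinear form `b` on `X`: every covector is
`b (u, ·)` for some `u`, and `P (b (u, ·), b (v, ·)) = b (u, v)`. -/
structure IsDualForm (b : LinearMap.BilinForm ℝ X)
    (P : Module.Dual ℝ X →ₗ[ℝ] Module.Dual ℝ X →ₗ[ℝ] ℝ) : Prop where
  surjective : Function.Surjective b
  apply_apply : ∀ u v, P (b u) (b v) = b u v

/-- Pulling `b' (T w)` back along `T` gives `b w`, and surjectivity of `T` makes every covector of
this form. This serves both the invariance along fibres and the case where `φ` is a diffeomorphism.
-/
theorem IsDualForm.apply_dualMap {b : LinearMap.BilinForm ℝ X} {b' : LinearMap.BilinForm ℝ X'}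
    {P : Module.Dual ℝ X →ₗ[ℝ] Module.Dual ℝ X →ₗ[ℝ] ℝ}
    {P' : Module.Dual ℝ X' →ₗ[ℝ] Module.Dual ℝ X' →ₗ[ℝ] ℝ}
    (hP : IsDualForm b P) (hP' : IsDualForm b' P') {T : X →ₗ[ℝ] X'}
    (hT : Function.Surjective T) (hb : ∀ u v, b' (T u) (T v) = b u v)
    (α β : Module.Dual ℝ X') : P (T.dualMap α) (T.dualMap β) = P' α β := by
  obtain ⟨u', rfl⟩ := hP'.surjective α
  obtain ⟨v', rfl⟩ := hP'.surjective β
  obtain ⟨u, rfl⟩ := hT u'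
  obtain ⟨v, rfl⟩ := hT v'
  have h : ∀ w, T.dualMap (b' (T w)) = b w := fun w => by
    ext z
    simp [hb]
  rw [h, h, hP.apply_apply, hP'.apply_apply, hb]

/-- The splitting of the dual of a quotient `Y'` of a symplectic space `X'`, induced by a
symplectic subspace of `X'` containing the kernel of `X' → Y'`. -/
theorem IsDualForm.splitting {Y Y' : Type*} [AddCommGroup Y] [Module ℝ Y] [AddCommGroup Y']
    [Module ℝ Y'] {b : LinearMap.BilinForm ℝ X} {b' : LinearMap.BilinForm ℝ X'}
    {P : Module.Dual ℝ X →ₗ[ℝ] Module.Dual ℝ X →ₗ[ℝ] ℝ}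
    {P' : Module.Dual ℝ X' →ₗ[ℝ] Module.Dual ℝ X' →ₗ[ℝ] ℝ}
    (hP : IsDualForm b P) (hP' : IsDualForm b' P') (hs : ∀ u v, b' u v = -b' v u)
    {p : X →ₗ[ℝ] Y} {p' : X' →ₗ[ℝ] Y'} {T : X →ₗ[ℝ] X'} {τ : Y →ₗ[ℝ] Y'}
    (hp : Function.Surjective p) (hp' : Function.Surjective p')
    (hτ : τ ∘ₗ p = p' ∘ₗ T) (hT : ∀ u v, b' (T u) (T v) = b u v)
    (hk : LinearMap.ker p' ≤ LinearMap.range T)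
    {L : Module.Dual ℝ Y →ₗ[ℝ] Module.Dual ℝ Y →ₗ[ℝ] ℝ}
    {L' : Module.Dual ℝ Y' →ₗ[ℝ] Module.Dual ℝ Y' →ₗ[ℝ] ℝ}
    (hL : ∀ α β, L α β = P (p.dualMap α) (p.dualMap β))
    (hL' : ∀ α β, L' α β = P' (p'.dualMap α) (p'.dualMap β))
    {C D : Submodule ℝ (Module.Dual ℝ Y')} (hC : C = (LinearMap.range τ).dualAnnihilator)
    (hD : ∀ σ, σ ∈ D ↔ ∀ γ ∈ C, L' γ σ = 0) :
    ∃ h : IsCompl C D, ∀ σ₁ σ₂, L (τ.dualMap σ₁) (τ.dualMap σ₂) =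
      L' σ₁ σ₂ - L' (C.projection D h σ₁) (C.projection D h σ₂) := by
  have hτ' : ∀ x, τ (p x) = p' (T x) := fun x => LinearMap.congr_fun hτ x
  -- If `u` represents the pullback of `σ`, then `σ` is conormal exactly when `u` is orthogonal to
  -- `S = T X`.
  have hCmem : ∀ {σ u}, b' u = p'.dualMap σ → (σ ∈ C ↔ ∀ z, b' u (T z) = 0) := by
    intro σ u hu
    rw [hC, Submodule.mem_dualAnnihilator]
    constructor
    · intro h z
      rw [hu, LinearMap.dualMap_apply, ← hτ']
      exact h _ ⟨_, rfl⟩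
    · rintro h _ ⟨y, rfl⟩
      obtain ⟨x, rfl⟩ := hp y
      rw [hτ', ← LinearMap.dualMap_apply, ← hu, h]
  -- Orthogonal decomposition along `S`: the restriction of `b' u` to `X` is represented by some
  -- `x`, because `b` is onto the dual.
  have hdecomp : ∀ u, ∃ x, ∀ z, b' (u - T x) (T z) = 0 := by
    intro u
    obtain ⟨x, hx⟩ := hP.surjective (T.dualMap (b' u))
    refine ⟨x, fun z => ?_⟩
    have := LinearMap.congr_fun hx z
    rw [LinearMap.dualMap_apply] at this
    rw [map_sub, LinearMap.sub_apply, hT, this, sub_self]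
  -- A vector orthogonal to `S` pairs to zero with `ker p' ⊆ S`, so its covector descends to `Y'`.
  have hlift : ∀ w, (∀ z, b' w (T z) = 0) → ∃ γ ∈ C, b' w = p'.dualMap γ := by
    intro w hw
    have hmem : b' w ∈ (LinearMap.ker p').dualAnnihilator := by
      rw [Submodule.mem_dualAnnihilator]
      intro k hk'
      obtain ⟨z, rfl⟩ := hk hk'
      exact hw z
    rw [← LinearMap.range_dualMap_eq_dualAnnihilator_ker_of_surjective p' hp'] at hmem
    obtain ⟨γ, hγ⟩ := hmem
    exact ⟨γ, (hCmem hγ.symm).2 hw, hγ.symm⟩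
  have hDmem : ∀ {σ x}, b' (T x) = p'.dualMap σ → σ ∈ D := by
    intro σ x hx
    rw [hD]
    intro γ hγ
    obtain ⟨c, hc⟩ := hP'.surjective (p'.dualMap γ)
    rw [hL', ← hc, ← hx, hP'.apply_apply, (hCmem hc).1 hγ]
  have hsplit : ∀ σ, ∃ γ ∈ C, ∃ x, b' (T x) = p'.dualMap (σ - γ) := by
    intro σ
    obtain ⟨u, hu⟩ := hP'.surjective (p'.dualMap σ)
    obtain ⟨x, hx⟩ := hdecomp u
    obtain ⟨γ, hγ, hw⟩ := hlift _ hx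
    exact ⟨γ, hγ, x, by rw [map_sub, ← hw, ← hu, ← map_sub, sub_sub_cancel]⟩
  have h : IsCompl C D := by
    constructor
    · rw [Submodule.disjoint_def]
      intro σ hσC hσD
      obtain ⟨u, hu⟩ := hP'.surjective (p'.dualMap σ)
      have huT := (hCmem hu).1 hσC
      -- Here `u` is orthogonal to `S` because `σ ∈ C`, and to every vector orthogonal to `S`
      -- because `σ ∈ D`; these vectors together span `X'`.
      have h0 : b' u = 0 := by
        ext a
        obtain ⟨x, hx⟩ := hdecomp a
        obtain ⟨γ, hγ, hw⟩ := hlift _ hx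
        have h1 := (hD σ).1 hσD γ hγ
        rw [hL', ← hw, ← hu, hP'.apply_apply, hs, neg_eq_zero, map_sub, huT, sub_zero] at h1
        exact h1
      rw [h0] at hu
      exact LinearMap.dualMap_injective_of_surjective hp' (by rw [← hu, map_zero])
    · rw [codisjoint_iff, eq_top_iff]
      intro σ _
      obtain ⟨γ, hγ, x, hx⟩ := hsplit σ
      exact Submodule.mem_sup.2 ⟨γ, hγ, σ - γ, hDmem hx, by abel⟩
  refine ⟨h, fun σ₁ σ₂ => ?_⟩
  -- The `D`-component of any covector is represented by a vector of `S`, on which `b'` can be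
  -- compared with `b`.
  have hproj : ∀ σ, ∃ δ ∈ D, ∃ x, b' (T x) = p'.dualMap δ ∧ σ = C.projection D h σ + δ := by
    intro σ
    obtain ⟨γ, hγ, x, hx⟩ := hsplit σ
    refine ⟨σ - γ, hDmem hx, x, hx, ?_⟩
    have : C.projection D h σ = γ := by
      conv_lhs => rw [← add_sub_cancel γ σ]
      rw [map_add, Submodule.projection_apply_of_mem_left h hγ,
        Submodule.projection_apply_of_mem_right h (hDmem hx), add_zero]
    rw [this]
    abel
  obtain ⟨δ₁, hδ₁, x₁, hx₁, e₁⟩ := hproj σ₁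
  obtain ⟨δ₂, hδ₂, x₂, hx₂, e₂⟩ := hproj σ₂
  have hγ₁ := Submodule.projection_apply_mem h σ₁
  have hγ₂ := Submodule.projection_apply_mem h σ₂
  set γ₁ := C.projection D h σ₁
  set γ₂ := C.projection D h σ₂
  have hL's : ∀ α β, L' α β = -L' β α := by
    intro α β
    obtain ⟨u, hu⟩ := hP'.surjective (p'.dualMap α)
    obtain ⟨v, hv⟩ := hP'.surjective (p'.dualMap β)
    rw [hL', hL', ← hu, ← hv, hP'.apply_apply, hP'.apply_apply, hs]
  have hτC : ∀ γ ∈ C, τ.dualMap γ = 0 := by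
    intro γ hγ
    rw [hC, Submodule.mem_dualAnnihilator] at hγ
    ext y
    exact hγ _ ⟨y, rfl⟩
  have hδ : ∀ {δ x}, b' (T x) = p'.dualMap δ → p.dualMap (τ.dualMap δ) = b x := by
    intro δ x hx
    ext z
    rw [LinearMap.dualMap_apply, LinearMap.dualMap_apply, hτ', ← LinearMap.dualMap_apply, ← hx,
      hT]
  have h12 : L' γ₁ δ₂ = 0 := (hD _).1 hδ₂ _ hγ₁
  have h21 : L' δ₁ γ₂ = 0 := by rw [hL's, (hD _).1 hδ₁ _ hγ₂, neg_zero]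
  -- On the `D`-components both sides equal `b x₁ x₂`. The `C`-components vanish under `τ.dualMap`
  -- and are `L'`-orthogonal to `D`, so nothing else contributes to the difference.
  have hmain : L (τ.dualMap δ₁) (τ.dualMap δ₂) = L' δ₁ δ₂ := by
    rw [hL, hL', hδ hx₁, hδ hx₂, ← hx₁, ← hx₂, hP.apply_apply, hP'.apply_apply, hT]
  rw [e₁, e₂]
  simp only [map_add, LinearMap.add_apply, hτC _ hγ₁, hτC _ hγ₂, map_zero, LinearMap.zero_apply,
    h12, h21, hmain]
  ring

end LinearAlgebra

/-! ### Chain rules, chart derivatives and covectors as differentials -/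

section Differentials

variable {E : Type*} [NormedAddCommGroup E] [NormedSpace ℝ E]
  {M : Type*} [TopologicalSpace M] [ChartedSpace E M]
  {E' : Type*} [NormedAddCommGroup E'] [NormedSpace ℝ E']
  {M' : Type*} [TopologicalSpace M'] [ChartedSpace E' M']
  {E'' : Type*} [NormedAddCommGroup E''] [NormedSpace ℝ E'']
  {M'' : Type*} [TopologicalSpace M''] [ChartedSpace E'' M'']

theorem differential_comp {φ : M → M'} {f : M' → ℝ} {x : M}
    (hf : MDifferentiableAt 𝓘(ℝ, E') 𝓘(ℝ, ℝ) f (φ x))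
    (hφ : MDifferentiableAt 𝓘(ℝ, E) 𝓘(ℝ, E') φ x) :
    differential E (f ∘ φ) x = (tangent E E' φ x).dualMap (differential E' f (φ x)) := by
  unfold differential tangent mvfderiv
  rw [mfderiv_comp x hf hφ]
  rfl

theorem tangent_comp {φ : M → M'} {ψ : M' → M''} {x : M}
    (hψ : MDifferentiableAt 𝓘(ℝ, E') 𝓘(ℝ, E'') ψ (φ x))
    (hφ : MDifferentiableAt 𝓘(ℝ, E) 𝓘(ℝ, E') φ x) :
    tangent E E'' (ψ ∘ φ) x = tangent E' E'' ψ (φ x) ∘ₗ tangent E E' φ x := by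
  unfold tangent
  rw [mfderiv_comp x hψ hφ]
  rfl

theorem tangent_comp_apply {φ : M → M'} {ψ : M' → M''} {x : M}
    (hψ : MDifferentiableAt 𝓘(ℝ, E') 𝓘(ℝ, E'') ψ (φ x))
    (hφ : MDifferentiableAt 𝓘(ℝ, E) 𝓘(ℝ, E') φ x) (u : TangentSpace 𝓘(ℝ, E) x) :
    tangent E E'' (ψ ∘ φ) x u = tangent E' E'' ψ (φ x) (tangent E E' φ x u) := by
  rw [tangent_comp hψ hφ]
  rfl

theorem mdifferentiableAt_of_contMDiff {φ : M → M'} (hφ : ContMDiff 𝓘(ℝ, E) 𝓘(ℝ, E') ∞ φ)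
    (x : M) : MDifferentiableAt 𝓘(ℝ, E) 𝓘(ℝ, E') φ x :=
  (hφ x).mdifferentiableAt (by simp)

variable [IsManifold 𝓘(ℝ, E) ∞ M]

theorem mdifferentiableAt_extChartAt_symm {x : M} {y : E}
    (hy : y ∈ (extChartAt 𝓘(ℝ, E) x).target) :
    MDifferentiableAt 𝓘(ℝ, E) 𝓘(ℝ, E) (extChartAt 𝓘(ℝ, E) x).symm y :=
  ((contMDiffOn_extChartAt_symm (n := ∞) x).contMDiffAt
    ((isOpen_extChartAt_target x).mem_nhds hy)).mdifferentiableAt (by simp)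

theorem bijective_tangent_extChartAt_symm {x : M} {y : E}
    (hy : y ∈ (extChartAt 𝓘(ℝ, E) x).target) :
    Function.Bijective (tangent E E (extChartAt 𝓘(ℝ, E) x).symm y) := by
  have : IsManifold 𝓘(ℝ, E) 1 M := IsManifold.of_le (n := ∞) (by simp)
  have h := isInvertible_mfderivWithin_extChartAt_symm hy
  rw [ModelWithCorners.range_eq_univ, mfderivWithin_univ] at h
  exact h.bijective

/-- Every covector on a Hausdorff manifold is the differential of a global smooth function. -/
theorem exists_differential_eq [FiniteDimensional ℝ E] [T2Space M] (x : M) (α : Cotangent E x) :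
    ∃ f : M → ℝ, ContMDiff 𝓘(ℝ, E) 𝓘(ℝ, ℝ) ∞ f ∧ differential E f x = α := by
  have : IsManifold 𝓘(ℝ, E) 1 M := IsManifold.of_le (n := ∞) (by simp)
  obtain ⟨T₀, hT⟩ := isInvertible_mfderiv_extChartAt (I := 𝓘(ℝ, E)) (mem_extChartAt_source x)
  let T : E ≃L[ℝ] E := T₀
  let α' : E →ₗ[ℝ] ℝ := α
  -- With `T` the derivative of the chart at `x`, the function `l ∘ chart` has differential `α`
  -- there; multiplying by a bump function makes it global and keeps its germ at `x`.
  let l : E →L[ℝ] ℝ := α'.toContinuousLinearMap.comp (T.symm : E →L[ℝ] E)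
  obtain ⟨b⟩ : Nonempty (SmoothBumpFunction 𝓘(ℝ, E) x) := inferInstance
  have hl : ContMDiffOn 𝓘(ℝ, E) 𝓘(ℝ, ℝ) ∞ (fun z => l (extChartAt 𝓘(ℝ, E) x z))
      (chartAt E x).source :=
    l.contDiff.contMDiff.comp_contMDiffOn contMDiffOn_extChartAt
  refine ⟨fun z => b z • l (extChartAt 𝓘(ℝ, E) x z), b.contMDiff_smul hl, ?_⟩
  have he : (fun z => b z • l (extChartAt 𝓘(ℝ, E) x z)) =ᶠ[nhds x]
      l ∘ extChartAt 𝓘(ℝ, E) x := by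
    filter_upwards [b.eventuallyEq_one] with z hz
    simp [hz]
  have hd : mfderiv 𝓘(ℝ, E) 𝓘(ℝ, ℝ) (fun z => b z • l (extChartAt 𝓘(ℝ, E) x z)) x =
      l.comp (T : E →L[ℝ] E) := by
    rw [he.mfderiv_eq, mfderiv_comp x l.mdifferentiableAt
      (mdifferentiableAt_extChartAt (mem_chart_source E x)), ContinuousLinearMap.mfderiv_eq, ← hT]
    rfl
  ext u
  have h := congrArg (fun L : TangentSpace 𝓘(ℝ, E) x →L[ℝ] ℝ => L u) hd
  refine Eq.trans h ?_
  exact congrArg α' (T.symm_apply_apply (u : E))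

theorem contDiffOn_comp_extChartAt_symm {f : M → ℝ} (hf : ContMDiff 𝓘(ℝ, E) 𝓘(ℝ, ℝ) ∞ f)
    (x₀ : M) : ContDiffOn ℝ ∞ (f ∘ (extChartAt 𝓘(ℝ, E) x₀).symm)
      (extChartAt 𝓘(ℝ, E) x₀).target :=
  contMDiffOn_iff_contDiffOn.1 (hf.comp_contMDiffOn (contMDiffOn_extChartAt_symm x₀))

end Differentials

/-! ### The Poisson structure of a symplectic manifold -/

section Symplectic

variable {E : Type*} [NormedAddCommGroup E] [NormedSpace ℝ E] 
  {M : Type*} [TopologicalSpace M] [ChartedSpace E M]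

theorem SymplecticForm.bilin_skew (Ω : SymplecticForm E M) (x : M)
    (u v : TangentSpace 𝓘(ℝ, E) x) : Ω.bilin x u v = -Ω.bilin x v u := by
  have h := (Ω.form x).map_swap ![u, v] (i := 0) (j := 1) (by decide)
  have e : ![u, v] ∘ Equiv.swap (0 : Fin 2) 1 = ![v, u] := by
    ext i; fin_cases i <;> rfl
  rw [e] at h
  exact neg_eq_iff_eq_neg.1 h.symm

variable [FiniteDimensional ℝ E]

theorem SymplecticForm.isDualForm (Ω : SymplecticForm E M) (x : M) :
    IsDualForm (Ω.bilin x) (Ω.poisson x) where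
  surjective α := ⟨(Ω.flat x).symm α, (Ω.flat x).apply_symm_apply α⟩
  apply_apply u v := by
    have h : ∀ u, (Ω.flat x).symm (Ω.bilin x u) = u := (Ω.flat x).symm_apply_apply
    change Ω.bilin x ((Ω.flat x).symm (Ω.bilin x u)) ((Ω.flat x).symm (Ω.bilin x v)) = _
    rw [h, h]

theorem SymplecticForm.poisson_skew (Ω : SymplecticForm E M) (x : M) (α β : Cotangent E x) :
    Ω.poisson x α β = -Ω.poisson x β α :=
  Ω.bilin_skew x _ _

/-- The local expression of a symplectic form in a chart, as a field of bilinear forms. -/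
def SymplecticForm.localBilin (Ω : SymplecticForm E M) (x₀ : M) (y : E) : E →L[ℝ] E →L[ℝ] ℝ :=
  LinearMap.toContinuousBilinearMap (E := E) (F := E)
    ((Ω.bilin ((extChartAt 𝓘(ℝ, E) x₀).symm y)).compl₁₂
      (tangent E E (extChartAt 𝓘(ℝ, E) x₀).symm y)
      (tangent E E (extChartAt 𝓘(ℝ, E) x₀).symm y))

theorem SymplecticForm.localBilin_apply (Ω : SymplecticForm E M) (x₀ : M) (y u v : E) :
    Ω.localBilin x₀ y u v = localForm Ω.form x₀ y ![u, v] := by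
  change Ω.form _ ![_, _] = Ω.form _ (_ ∘ ![u, v])
  congr 1
  ext i; fin_cases i <;> rfl

theorem SymplecticForm.contDiffOn_localBilin (Ω : SymplecticForm E M) (x₀ : M) :
    ContDiffOn ℝ ∞ (Ω.localBilin x₀) (extChartAt 𝓘(ℝ, E) x₀).target := by
  refine contDiffOn_clm_apply.2 fun u => contDiffOn_clm_apply.2 fun v => ?_
  simp only [Ω.localBilin_apply]
  exact (ContinuousAlternatingMap.apply ℝ E ℝ ![u, v]).contDiff.comp_contDiffOn (Ω.smooth x₀)

theorem isInvertible_of_injective {B : E →L[ℝ] E →L[ℝ] ℝ} (hB : Function.Injective B) :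
    B.IsInvertible := by
  have hd : Module.finrank ℝ E = Module.finrank ℝ (E →L[ℝ] ℝ) := by
    rw [← (LinearMap.toContinuousLinearMap (𝕜 := ℝ) (E := E) (F' := ℝ)).finrank_eq]
    exact (Subspace.dual_finrank_eq).symm
  exact ⟨(LinearEquiv.ofInjectiveOfFinrankEq (B : E →ₗ[ℝ] E →L[ℝ] ℝ) hB hd).toContinuousLinearEquiv,
    by ext; rfl⟩

/-- The exterior derivative evaluated on three constant vectors is the alternating sum of
directional derivatives. -/
theorem SymplecticForm.localBilin_closed (Ω : SymplecticForm E M) (x₀ : M) {y : E}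
    (hy : y ∈ (extChartAt 𝓘(ℝ, E) x₀).target) (u v w : E) :
    fderiv ℝ (Ω.localBilin x₀) y u v w - fderiv ℝ (Ω.localBilin x₀) y v u w
      + fderiv ℝ (Ω.localBilin x₀) y w u v = 0 := by
  have hUy := (isOpen_extChartAt_target x₀).mem_nhds hy
  have hd := ((Ω.smooth x₀).contDiffAt hUy).differentiableAt (by simp)
  have hWd := ((Ω.contDiffOn_localBilin x₀).contDiffAt hUy).differentiableAt (by simp)
  have key : ∀ a b c : E, fderiv ℝ (Ω.localBilin x₀) y c a b =
      fderiv ℝ (fun z => localForm Ω.form x₀ z ![a, b]) y c := fun a b c => by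
    simp only [← Ω.localBilin_apply]
    rw [fderiv_clm_apply (hWd.clm_apply (differentiableAt_const a)) (differentiableAt_const b),
      fderiv_clm_apply hWd (differentiableAt_const a)]
    simp
  have h := congrArg (fun η : E [⋀^Fin 3]→L[ℝ] ℝ => η ![u, v, w]) (Ω.closed x₀ y hy)
  simp only [extDeriv_apply hd] at h
  have e0 : (0 : Fin 3).removeNth ![u, v, w] = ![v, w] := by
    ext i; fin_cases i <;> rfl
  have e1 : (1 : Fin 3).removeNth ![u, v, w] = ![u, w] := by
    ext i; fin_cases i <;> rfl
  have e2 : (2 : Fin 3).removeNth ![u, v, w] = ![u, v] := by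
    ext i; fin_cases i <;> rfl
  rw [Fin.sum_univ_three, e0, e1, e2] at h
  rw [key, key, key]
  simpa [sub_eq_add_neg] using h

variable [IsManifold 𝓘(ℝ, E) ∞ M]

theorem SymplecticForm.isInvertible_localBilin (Ω : SymplecticForm E M) (x₀ : M) {y : E}
    (hy : y ∈ (extChartAt 𝓘(ℝ, E) x₀).target) : (Ω.localBilin x₀ y).IsInvertible := by
  have hb := bijective_tangent_extChartAt_symm hy
  refine isInvertible_of_injective ((injective_iff_map_eq_zero _).2 fun u hu => ?_)
  refine hb.1 (Eq.trans ?_ (map_zero (tangent E E (extChartAt 𝓘(ℝ, E) x₀).symm y)).symm)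
  refine Ω.nondegenerate _ _ fun w => ?_
  obtain ⟨v, rfl⟩ := hb.2 w
  exact congrArg (fun l : E →L[ℝ] ℝ => l v) hu

/-- The inverse chart carries the local Hamiltonian vector of `k ∘ chart⁻¹` to the vector that
represents `dk` through `Ω`. This moves smoothness and Jacobi into an open subset of `E`. -/
theorem SymplecticForm.bracket_extChartAt_symm (Ω : SymplecticForm E M) (x₀ : M) {y : E}
    (hy : y ∈ (extChartAt 𝓘(ℝ, E) x₀).target) {f g : M → ℝ}
    (hf : ContMDiff 𝓘(ℝ, E) 𝓘(ℝ, ℝ) ∞ f) (hg : ContMDiff 𝓘(ℝ, E) 𝓘(ℝ, ℝ) ∞ g) :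
    Ω.poisson.bracket f g ((extChartAt 𝓘(ℝ, E) x₀).symm y) =
      localBracket (Ω.localBilin x₀) (f ∘ (extChartAt 𝓘(ℝ, E) x₀).symm)
        (g ∘ (extChartAt 𝓘(ℝ, E) x₀).symm) y := by
  have hb := bijective_tangent_extChartAt_symm hy
  have key : ∀ {k : M → ℝ}, ContMDiff 𝓘(ℝ, E) 𝓘(ℝ, ℝ) ∞ k →
      Ω.bilin ((extChartAt 𝓘(ℝ, E) x₀).symm y)
        (tangent E E (extChartAt 𝓘(ℝ, E) x₀).symm y (hamiltonianField (E := E) (Ω.localBilin x₀)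
          (k ∘ (extChartAt 𝓘(ℝ, E) x₀).symm) y)) =
        differential E k ((extChartAt 𝓘(ℝ, E) x₀).symm y) := by
    intro k hk
    ext w
    obtain ⟨u, rfl⟩ := hb.2 w
    have hd := LinearMap.congr_fun (differential_comp (mdifferentiableAt_of_contMDiff hk _)
      (mdifferentiableAt_extChartAt_symm hy)) u
    have h := DFunLike.congr_fun (F := E →L[ℝ] ℝ) (apply_hamiltonianField
      (f := k ∘ (extChartAt 𝓘(ℝ, E) x₀).symm) (Ω.isInvertible_localBilin x₀ hy)) u
    refine Eq.trans h (Eq.trans ?_ hd)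
    unfold differential mvfderiv
    rw [mfderiv_eq_fderiv]
    rfl
  rw [Bivector.bracket, ← key hf, ← key hg, (Ω.isDualForm _).apply_apply]
  rfl

theorem SymplecticForm.contMDiff_bracket (Ω : SymplecticForm E M) {f g : M → ℝ}
    (hf : ContMDiff 𝓘(ℝ, E) 𝓘(ℝ, ℝ) ∞ f) (hg : ContMDiff 𝓘(ℝ, E) 𝓘(ℝ, ℝ) ∞ g) :
    ContMDiff 𝓘(ℝ, E) 𝓘(ℝ, ℝ) ∞ (Ω.poisson.bracket f g) := by
  intro x
  have hx := mem_extChartAt_target (I := 𝓘(ℝ, E)) x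
  have hUx := (isOpen_extChartAt_target (I := 𝓘(ℝ, E)) x).mem_nhds hx
  have h := contDiffAt_localBracket ((Ω.contDiffOn_localBilin x).contDiffAt hUx)
    (Ω.isInvertible_localBilin x hx) ((contDiffOn_comp_extChartAt_symm hf x).contDiffAt hUx)
    ((contDiffOn_comp_extChartAt_symm hg x).contDiffAt hUx)
  refine (h.contMDiffAt.comp x contMDiffAt_extChartAt).congr_of_eventuallyEq ?_
  filter_upwards [(isOpen_extChartAt_source (I := 𝓘(ℝ, E)) x).mem_nhds
    (mem_extChartAt_source x)] with z hz
  rw [Function.comp_apply, ← Ω.bracket_extChartAt_symm x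
    ((extChartAt 𝓘(ℝ, E) x).map_source hz) hf hg, (extChartAt 𝓘(ℝ, E) x).left_inv hz]

theorem SymplecticForm.bracket_bracket_eq (Ω : SymplecticForm E M) {f g h : M → ℝ}
    (hf : ContMDiff 𝓘(ℝ, E) 𝓘(ℝ, ℝ) ∞ f) (hg : ContMDiff 𝓘(ℝ, E) 𝓘(ℝ, ℝ) ∞ g)
    (hh : ContMDiff 𝓘(ℝ, E) 𝓘(ℝ, ℝ) ∞ h) (x : M) :
    Ω.poisson.bracket f (Ω.poisson.bracket g h) x =
      localBracket (Ω.localBilin x) (f ∘ (extChartAt 𝓘(ℝ, E) x).symm)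
        (localBracket (Ω.localBilin x) (g ∘ (extChartAt 𝓘(ℝ, E) x).symm)
          (h ∘ (extChartAt 𝓘(ℝ, E) x).symm)) (extChartAt 𝓘(ℝ, E) x x) := by
  have hx := mem_extChartAt_target (I := 𝓘(ℝ, E)) x
  have hUx := (isOpen_extChartAt_target (I := 𝓘(ℝ, E)) x).mem_nhds hx
  have h1 := Ω.bracket_extChartAt_symm x hx hf (Ω.contMDiff_bracket hg hh)
  rw [extChartAt_to_inv] at h1
  rw [h1]
  -- The outer bracket sees only the germ of its argument, so agreement of the inner brackets near
  -- the point suffices.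
  refine localBracket_congr_right ?_
  filter_upwards [hUx] with y hy using Ω.bracket_extChartAt_symm x hy hg hh

/-- The bracket of a symplectic form is a Poisson structure. -/
theorem SymplecticForm.isPoisson (Ω : SymplecticForm E M) : IsPoisson Ω.poisson where
  alt x α := by linarith [Ω.poisson_skew x α α]
  smooth _ _ := Ω.contMDiff_bracket
  jacobi f g h hf hg hh x := by
    have hx := mem_extChartAt_target (I := 𝓘(ℝ, E)) x
    rw [Ω.bracket_bracket_eq hf hg hh, Ω.bracket_bracket_eq hg hh hf,
      Ω.bracket_bracket_eq hh hf hg]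
    exact localBracket_jacobi (isOpen_extChartAt_target x) hx (Ω.contDiffOn_localBilin x)
      (fun _ hz => Ω.isInvertible_localBilin x hz) (fun _ _ u v => Ω.bilin_skew _ _ _)
      (Ω.localBilin_closed x hx) (contDiffOn_comp_extChartAt_symm hf x)
      (contDiffOn_comp_extChartAt_symm hg x) (contDiffOn_comp_extChartAt_symm hh x)

end Symplectic

/-! ### Velocities of curves -/

section Velocity

variable {E : Type*} [NormedAddCommGroup E] [NormedSpace ℝ E]
  {M : Type*} [TopologicalSpace M] [ChartedSpace E M]
  {E' : Type*} [NormedAddCommGroup E'] [NormedSpace ℝ E']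
  {M' : Type*} [TopologicalSpace M'] [ChartedSpace E' M']

variable (E) in
/-- The velocity at time `0` of a curve starting at `x`. -/
def velocity {c : ℝ → M} {x : M} (h : c 0 = x) : TangentSpace 𝓘(ℝ, E) x :=
  h ▸ tangent ℝ E c 0 (1 : ℝ)

theorem tangent_velocity {c : ℝ → M} {x : M} {φ : M → M'} (h : c 0 = x)
    (hφ : MDifferentiableAt 𝓘(ℝ, E) 𝓘(ℝ, E') φ x)
    (hc : MDifferentiableAt 𝓘(ℝ, ℝ) 𝓘(ℝ, E) c 0) :
    tangent E E' φ x (velocity E h) = velocity E' (c := φ ∘ c) (congrArg φ h) := by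
  subst h
  exact (tangent_comp_apply hφ hc _).symm

theorem velocity_congr {c c' : ℝ → M} {x : M} (h : c 0 = x) (h' : c' 0 = x) (hc : c = c') :
    velocity E h = velocity E h' := by
  subst hc
  rfl

theorem velocity_const (x : M) : velocity E (c := fun _ => x) (rfl : x = x) = 0 := by
  change tangent ℝ E (fun _ => x) (0 : ℝ) (1 : ℝ) = 0
  unfold tangent
  rw [mfderiv_const]
  rfl

theorem velocity_eq {c : ℝ → M} {x : M} (h : c 0 = x) :
    (velocity E h : E) = (tangent ℝ E c 0 (1 : ℝ) : E) := by
  subst h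
  rfl

end Velocity

/-! ### Maps that preserve symplectic forms -/

section SymplecticMaps

variable {E : Type*} [NormedAddCommGroup E] [NormedSpace ℝ E]
  {M : Type*} [TopologicalSpace M] [ChartedSpace E M]
  {E' : Type*} [NormedAddCommGroup E'] [NormedSpace ℝ E']
  {M' : Type*} [TopologicalSpace M'] [ChartedSpace E' M']

theorem bilin_tangent_of_pullbackForm_eq {Ω : SymplecticForm E M} {Ω' : SymplecticForm E' M'}
    {φ : M → M'} {x : M} (h : pullbackForm φ Ω'.form x = Ω.form x)
    (u v : TangentSpace 𝓘(ℝ, E) x) :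
    Ω'.bilin (φ x) (tangent E E' φ x u) (tangent E E' φ x v) = Ω.bilin x u v := by
  change Ω'.form (φ x) ![_, _] = Ω.form x ![u, v]
  rw [← h]
  change Ω'.form (φ x) ![_, _] = Ω'.form (φ x) (_ ∘ ![u, v])
  congr 1
  ext i; fin_cases i <;> rfl

/-- A vector in the kernel is `Ω`-orthogonal to every vector, hence zero by nondegeneracy. -/
theorem tangent_injective_of_pullbackForm_eq {Ω : SymplecticForm E M} {Ω' : SymplecticForm E' M'}
    {φ : M → M'} {x : M} (h : pullbackForm φ Ω'.form x = Ω.form x) :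
    Function.Injective (tangent E E' φ x) := by
  refine (injective_iff_map_eq_zero _).2 fun u hu => Ω.nondegenerate x u fun w => ?_
  change Ω.bilin x u w = 0
  rw [← bilin_tangent_of_pullbackForm_eq h, hu, map_zero, LinearMap.zero_apply]

end SymplecticMaps

/-! ### Local sections and the vertical line of a principal bundle -/

section Bundles

variable {EA EV A V : Type*}
  [NormedAddCommGroup EA] [NormedSpace ℝ EA] [NormedAddCommGroup EV] [NormedSpace ℝ EV]
  [TopologicalSpace A] [ChartedSpace EA A] [TopologicalSpace V] [ChartedSpace EV V]

/-- The section keeps the fibre coordinate of `a` constant in a trivialization. That it passes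
through a prescribed `a` yields submersivity and openness of `μ`; smoothness also descends along
such sections. -/
theorem PrincipalRBundle.exists_section (B : PrincipalRBundle EA EV A V) (a : A) :
    ∃ s : V → A, ContMDiffAt 𝓘(ℝ, EV) 𝓘(ℝ, EA) ∞ s (B.proj a) ∧ s (B.proj a) = a ∧
      ∀ᶠ w in nhds (B.proj a), B.proj (s w) = w := by
  obtain ⟨e, hv, -, hs, -⟩ := B.exists_trivialization (B.proj a)
  have ha : a ∈ e.source := e.mem_source.2 hv
  have hea : e a = (B.proj a, (e a).2) := Prod.ext (e.coe_fst ha) rfl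
  refine ⟨fun w => e.toOpenPartialHomeomorph.symm (w, (e a).2), ?_, ?_, ?_⟩
  · have ht : (B.proj a, (e a).2) ∈ e.target := hea ▸ e.map_source ha
    exact ContMDiffAt.comp (B.proj a)
      (hs.contMDiffAt (e.open_target.mem_nhds ht))
      (contMDiffAt_id.prodMk contMDiffAt_const)
  · change e.toOpenPartialHomeomorph.symm (B.proj a, (e a).2) = a
    rw [← hea]
    exact e.left_inv ha
  · filter_upwards [e.open_baseSet.mem_nhds hv] with w hw using e.proj_symm_apply' hw

theorem PrincipalRBundle.mdifferentiableAt_proj (B : PrincipalRBundle EA EV A V) (a : A) :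
    MDifferentiableAt 𝓘(ℝ, EA) 𝓘(ℝ, EV) B.proj a :=
  mdifferentiableAt_of_contMDiff B.contMDiff_proj a

theorem PrincipalRBundle.tangent_proj_surjective (B : PrincipalRBundle EA EV A V) (a : A) :
    Function.Surjective (tangent EA EV B.proj a) := by
  obtain ⟨s, hs, hsa, hp⟩ := B.exists_section a
  intro u
  have hd : MDifferentiableAt 𝓘(ℝ, EV) 𝓘(ℝ, EA) s (B.proj a) := hs.mdifferentiableAt (by simp)
  have h : mfderiv 𝓘(ℝ, EV) 𝓘(ℝ, EV) (B.proj ∘ s) (B.proj a) = ContinuousLinearMap.id ℝ EV := by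
    rw [Filter.EventuallyEq.mfderiv_eq (f₁ := B.proj ∘ s) (f := id) hp, mfderiv_id]
    rfl
  rw [mfderiv_comp (B.proj a) (B.mdifferentiableAt_proj _) hd] at h
  have h' := DFunLike.congr_fun (F := EV →L[ℝ] EV) h u
  rw [hsa] at h'
  exact ⟨_, h'⟩

theorem PrincipalRBundle.isOpenMap_proj (B : PrincipalRBundle EA EV A V) : IsOpenMap B.proj := by
  refine isOpenMap_iff_nhds_le.2 fun a U hU => ?_
  obtain ⟨s, hs, hsa, hp⟩ := B.exists_section a
  have h := hs.continuousAt.preimage_mem_nhds (t := B.proj ⁻¹' U) (by rw [hsa]; exact hU)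
  filter_upwards [h, hp] with w hw hw'
  rw [← hw']
  exact hw

theorem PrincipalRBundle.contMDiff_act_left (B : PrincipalRBundle EA EV A V) (s : ℝ) :
    ContMDiff 𝓘(ℝ, EA) 𝓘(ℝ, EA) ∞ (B.act s) :=
  B.contMDiff_act.comp (contMDiff_const.prodMk contMDiff_id)

theorem PrincipalRBundle.contMDiff_orbit (B : PrincipalRBundle EA EV A V) (a : A) :
    ContMDiff 𝓘(ℝ, ℝ) 𝓘(ℝ, EA) ∞ (fun s => B.act s a) :=
  B.contMDiff_act.comp (contMDiff_id.prodMk contMDiff_const)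

/-- The fundamental vector field of the principal action. -/
def PrincipalRBundle.vertical (B : PrincipalRBundle EA EV A V) (a : A) : TangentSpace 𝓘(ℝ, EA) a :=
  velocity EA (c := fun s => B.act s a) (B.act_zero a)

theorem PrincipalRBundle.tangent_proj_vertical (B : PrincipalRBundle EA EV A V) (a : A) :
    tangent EA EV B.proj a (B.vertical a) = 0 := by
  rw [vertical, tangent_velocity _ (B.mdifferentiableAt_proj a)
    (mdifferentiableAt_of_contMDiff (B.contMDiff_orbit a) 0), ← velocity_const (E := EV)]
  exact velocity_congr _ _ (funext fun s => B.proj_act s a)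

/-- In an equivariant trivialization a vector in the kernel has the form `(0, r)`, while the orbit
is a translated line with velocity `(0, 1)`. -/
theorem PrincipalRBundle.exists_eq_smul_vertical (B : PrincipalRBundle EA EV A V) {a : A}
    {w : TangentSpace 𝓘(ℝ, EA) a} (hw : tangent EA EV B.proj a w = 0) :
    ∃ r : ℝ, w = r • B.vertical a := by
  obtain ⟨e, hv, hes, hs, he⟩ := B.exists_trivialization (B.proj a)
  have ha : a ∈ e.source := e.mem_source.2 hv
  have hsrc := e.open_source.mem_nhds ha
  have hde : MDifferentiableAt 𝓘(ℝ, EA) (𝓘(ℝ, EV).prod 𝓘(ℝ, ℝ)) e a :=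
    (hes.contMDiffAt hsrc).mdifferentiableAt (by simp)
  have hds : MDifferentiableAt (𝓘(ℝ, EV).prod 𝓘(ℝ, ℝ)) 𝓘(ℝ, EA)
      e.toOpenPartialHomeomorph.symm (e a) :=
    (hs.contMDiffAt (e.open_target.mem_nhds (e.map_source ha))).mdifferentiableAt (by simp)
  have hd2 : MDifferentiableAt 𝓘(ℝ, EA) 𝓘(ℝ, ℝ) (fun x => (e x).2) a := hde.snd
  have h1 : mfderiv 𝓘(ℝ, EA) (𝓘(ℝ, EV).prod 𝓘(ℝ, ℝ)) e a =
      ((mfderiv 𝓘(ℝ, EA) 𝓘(ℝ, EV) B.proj a).prod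
        (mfderiv 𝓘(ℝ, EA) 𝓘(ℝ, ℝ) (fun x => (e x).2) a) : EA →L[ℝ] EV × ℝ) := by
    have hee : e =ᶠ[nhds a] fun x => (B.proj x, (e x).2) := by
      filter_upwards [hsrc] with x hx using Prod.ext (e.coe_fst hx) rfl
    exact Eq.trans (α := EA →L[ℝ] EV × ℝ) hee.mfderiv_eq
      (mfderiv_prodMk (B.mdifferentiableAt_proj a) hd2)
  let r : ℝ := mfderiv 𝓘(ℝ, EA) 𝓘(ℝ, ℝ) (fun x => (e x).2) a w
  have h2 : (mfderiv 𝓘(ℝ, EA) (𝓘(ℝ, EV).prod 𝓘(ℝ, ℝ)) e a w : EV × ℝ) = (0, r) := by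
    have := DFunLike.congr_fun (F := EA →L[ℝ] EV × ℝ) h1 w
    exact this.trans (Prod.ext hw rfl)
  have h3 : (mfderiv (𝓘(ℝ, EV).prod 𝓘(ℝ, ℝ)) 𝓘(ℝ, EA) e.toOpenPartialHomeomorph.symm (e a)
      (mfderiv 𝓘(ℝ, EA) (𝓘(ℝ, EV).prod 𝓘(ℝ, ℝ)) e a w) : EA) = w := by
    have hc := mfderiv_comp a hds hde
    have hid : mfderiv 𝓘(ℝ, EA) 𝓘(ℝ, EA) (e.toOpenPartialHomeomorph.symm ∘ e) a =
        ContinuousLinearMap.id ℝ EA := by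
      rw [Filter.EventuallyEq.mfderiv_eq (f₁ := e.toOpenPartialHomeomorph.symm ∘ e) (f := id)
        (by filter_upwards [hsrc] with x hx using e.left_inv hx), mfderiv_id]
      rfl
    exact (DFunLike.congr_fun (F := EA →L[ℝ] EA) (hc.symm.trans hid) w)
  refine ⟨r, ?_⟩
  -- The orbit of `a` read in the trivialization.
  let c : ℝ → V × ℝ := fun s => (B.proj a, (e a).2 + s)
  have hc0 : c 0 = e a := Prod.ext (e.coe_fst ha).symm (add_zero _)
  have hdt : HasMFDerivAt 𝓘(ℝ, ℝ) 𝓘(ℝ, ℝ) (fun s : ℝ => (e a).2 + s) 0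
      (ContinuousLinearMap.id ℝ ℝ) :=
    ((hasFDerivAt_id (0 : ℝ)).const_add (e a).2).hasMFDerivAt
  have hdc : HasMFDerivAt 𝓘(ℝ, ℝ) (𝓘(ℝ, EV).prod 𝓘(ℝ, ℝ)) c 0
      ((0 : ℝ →L[ℝ] EV).prod (ContinuousLinearMap.id ℝ ℝ)) :=
    (hasMFDerivAt_const (B.proj a) (0 : ℝ)).prodMk hdt
  have horb : (fun s => B.act s a) = e.toOpenPartialHomeomorph.symm ∘ c := by
    funext s
    have hsa : B.act s a ∈ e.source := e.mem_source.2 (by rw [B.proj_act]; exact hv)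
    have h : e (B.act s a) = c s := (he s a ha).trans (Prod.ext (e.coe_fst ha) rfl)
    rw [Function.comp_apply, ← h]
    exact (e.left_inv hsa).symm
  have h4 : (B.vertical a : EA) = mfderiv (𝓘(ℝ, EV).prod 𝓘(ℝ, ℝ)) 𝓘(ℝ, EA)
      e.toOpenPartialHomeomorph.symm (e a) ((0, 1) : EV × ℝ) := by
    refine (velocity_eq (c := fun s => B.act s a) (B.act_zero a)).trans ?_
    have h5 : mfderiv 𝓘(ℝ, ℝ) 𝓘(ℝ, EA) (e.toOpenPartialHomeomorph.symm ∘ c) 0 =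
        (mfderiv (𝓘(ℝ, EV).prod 𝓘(ℝ, ℝ)) 𝓘(ℝ, EA) e.toOpenPartialHomeomorph.symm (e a) :
          EV × ℝ →L[ℝ] EA).comp ((0 : ℝ →L[ℝ] EV).prod (ContinuousLinearMap.id ℝ ℝ)) := by
      rw [mfderiv_comp_of_eq hds hdc.mdifferentiableAt hc0, hdc.mfderiv]
      have hD : ∀ p, p = e a → (mfderiv (𝓘(ℝ, EV).prod 𝓘(ℝ, ℝ)) 𝓘(ℝ, EA)
          e.toOpenPartialHomeomorph.symm p : EV × ℝ →L[ℝ] EA) =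
          mfderiv (𝓘(ℝ, EV).prod 𝓘(ℝ, ℝ)) 𝓘(ℝ, EA) e.toOpenPartialHomeomorph.symm (e a) := by
        rintro _ rfl
        rfl
      exact congrArg (fun S : EV × ℝ →L[ℝ] EA =>
        S.comp ((0 : ℝ →L[ℝ] EV).prod (ContinuousLinearMap.id ℝ ℝ))) (hD _ hc0)
    rw [← horb] at h5
    exact DFunLike.congr_fun (F := ℝ →L[ℝ] EA) h5 1
  have h6 : (r • B.vertical a : EA) = mfderiv (𝓘(ℝ, EV).prod 𝓘(ℝ, ℝ)) 𝓘(ℝ, EA)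
      e.toOpenPartialHomeomorph.symm (e a) ((0, r) : EV × ℝ) := by
    let S : EV × ℝ →L[ℝ] EA :=
      mfderiv (𝓘(ℝ, EV).prod 𝓘(ℝ, ℝ)) 𝓘(ℝ, EA) e.toOpenPartialHomeomorph.symm (e a)
    have h7 : S (0, r) = r • S (0, 1) := by
      rw [← map_smul]
      simp
    exact (congrArg (fun z : EA => r • z) h4).trans h7.symm
  exact h3.symm.trans ((congrArg _ h2).trans h6.symm)

end Bundles

/-! ### The induced Poisson structure on the base -/

section Bundles

variable {EA EV A V : Type*}
  [NormedAddCommGroup EA] [NormedSpace ℝ EA] [NormedAddCommGroup EV] [NormedSpace ℝ EV]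
  [TopologicalSpace A] [ChartedSpace EA A] [TopologicalSpace V] [ChartedSpace EV V]
  {EA' EV' A' V' : Type*}
  [NormedAddCommGroup EA'] [NormedSpace ℝ EA'] [NormedAddCommGroup EV'] [NormedSpace ℝ EV']
  [TopologicalSpace A'] [ChartedSpace EA' A'] [TopologicalSpace V'] [ChartedSpace EV' V']

/-- A function on the base is smooth if its pullback to the total space is. -/
theorem PrincipalRBundle.contMDiff_of_comp_proj (B : PrincipalRBundle EA EV A V)
    {k : V → V'} (hk : ContMDiff 𝓘(ℝ, EA) 𝓘(ℝ, EV') ∞ (k ∘ B.proj)) :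
    ContMDiff 𝓘(ℝ, EV) 𝓘(ℝ, EV') ∞ k := by
  intro v
  obtain ⟨a, rfl⟩ := B.proj_surjective v
  obtain ⟨s, hs, -, hp⟩ := B.exists_section a
  refine ((hk _).comp (B.proj a) hs).congr_of_eventuallyEq ?_
  filter_upwards [hp] with w hw
  simp only [Function.comp_apply, hw]

/-- The tangent map of the projection at `a`, with values in the tangent space at `v`; this is
meaningful if `a` lies over `v`. -/
def PrincipalRBundle.tangentProjTo (B : PrincipalRBundle EA EV A V) (v : V) (a : A) :
    TangentSpace 𝓘(ℝ, EA) a →ₗ[ℝ] TangentSpace 𝓘(ℝ, EV) v :=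
  tangent EA EV B.proj a

theorem PrincipalRBundle.tangentProjTo_act (B : PrincipalRBundle EA EV A V) (v : V) (s : ℝ)
    (a : A) : B.tangentProjTo v (B.act s a) ∘ₗ tangent EA EA (B.act s) a =
      B.tangentProjTo v a := by
  have hp : B.proj ∘ B.act s = B.proj := funext (B.proj_act s)
  -- The tangent maps of equal functions have targets based at different expressions; reading them
  -- as maps `EA → EV` allows the substitution.
  have heq : ∀ k : A → V, k = B.proj →
      (tangent EA EV k a : EA →ₗ[ℝ] EV) = tangent EA EV B.proj a := by
    rintro _ rfl
    rfl
  have hT := heq _ hp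
  rw [tangent_comp (B.mdifferentiableAt_proj _)
    (mdifferentiableAt_of_contMDiff (B.contMDiff_act_left s) a)] at hT
  exact hT

section Induced

variable [FiniteDimensional ℝ EA]

/-- The value at `v`, computed at the point `a` over `v`, of the Poisson structure induced on the
base. -/
def SymplecticRBundle.pushPoisson (B : SymplecticRBundle EA EV A V) (v : V) (a : A) :
    Cotangent EV v →ₗ[ℝ] Cotangent EV v →ₗ[ℝ] ℝ :=
  (B.symp.poisson a).compl₁₂ (B.tangentProjTo v a).dualMap (B.tangentProjTo v a).dualMap

/-- The tangent map of `ψ_s` is symplectic, hence injective, and bijective by equality of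
dimensions; it also commutes with projection to the base. Thus the pushed form is constant along a
fibre. -/
theorem SymplecticRBundle.pushPoisson_act (B : SymplecticRBundle EA EV A V) (v : V) (s : ℝ)
    (a : A) : B.pushPoisson v a = B.pushPoisson v (B.act s a) := by
  have hs := B.symplectic_act s a
  have hinj := tangent_injective_of_pullbackForm_eq hs
  let T : EA →ₗ[ℝ] EA := tangent EA EA (B.act s) a
  have hsurj : Function.Surjective (tangent EA EA (B.act s) a) :=
    LinearMap.surjective_of_injective (f := T) hinj
  ext α β
  rw [pushPoisson, pushPoisson, LinearMap.compl₁₂_apply, LinearMap.compl₁₂_apply,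
    ← B.tangentProjTo_act v s a, ← LinearMap.dualMap_comp_dualMap]
  exact (B.symp.isDualForm a).apply_dualMap (B.symp.isDualForm (B.act s a)) hsurj
    (bilin_tangent_of_pullbackForm_eq hs) _ _

/-- The Poisson structure induced on the base of a symplectic principal bundle. -/
def SymplecticRBundle.inducedPoisson (B : SymplecticRBundle EA EV A V) : Bivector EV V :=
  fun v => B.pushPoisson v (Function.surjInv B.proj_surjective v)

theorem SymplecticRBundle.inducedPoisson_proj (B : SymplecticRBundle EA EV A V) (a : A)
    (α β : Cotangent EV (B.proj a)) :
    B.inducedPoisson (B.proj a) α β =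
      B.symp.poisson a ((tangent EA EV B.proj a).dualMap α)
        ((tangent EA EV B.proj a).dualMap β) := by
  obtain ⟨s, hs⟩ := B.exists_act_eq (Function.surjInv_eq B.proj_surjective (B.proj a))
  have h : B.inducedPoisson (B.proj a) = B.pushPoisson (B.proj a) a := by
    rw [inducedPoisson, B.pushPoisson_act _ s, hs]
  rw [h]
  rfl

theorem SymplecticRBundle.bracket_inducedPoisson_proj (B : SymplecticRBundle EA EV A V)
    {f g : V → ℝ} (hf : ContMDiff 𝓘(ℝ, EV) 𝓘(ℝ, ℝ) ∞ f) (hg : ContMDiff 𝓘(ℝ, EV) 𝓘(ℝ, ℝ) ∞ g) :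
    B.inducedPoisson.bracket f g ∘ B.proj = B.symp.poisson.bracket (f ∘ B.proj) (g ∘ B.proj) := by
  funext a
  rw [Function.comp_apply, Bivector.bracket, Bivector.bracket, inducedPoisson_proj,
    differential_comp (mdifferentiableAt_of_contMDiff hf _) (B.mdifferentiableAt_proj a),
    differential_comp (mdifferentiableAt_of_contMDiff hg _) (B.mdifferentiableAt_proj a)]

/-- Pullback by `μ` intertwines the brackets, so smoothness and Jacobi are inherited from `A`. -/
theorem SymplecticRBundle.isInducedPoisson [IsManifold 𝓘(ℝ, EA) ∞ A]
    (B : SymplecticRBundle EA EV A V) : IsInducedPoisson B B.inducedPoisson := by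
  have hsmooth : ∀ f g : V → ℝ, ContMDiff 𝓘(ℝ, EV) 𝓘(ℝ, ℝ) ∞ f →
      ContMDiff 𝓘(ℝ, EV) 𝓘(ℝ, ℝ) ∞ g →
      ContMDiff 𝓘(ℝ, EV) 𝓘(ℝ, ℝ) ∞ (B.inducedPoisson.bracket f g) := fun f g hf hg => by
    refine B.contMDiff_of_comp_proj ?_
    rw [B.bracket_inducedPoisson_proj hf hg]
    exact B.symp.contMDiff_bracket (hf.comp B.contMDiff_proj) (hg.comp B.contMDiff_proj)
  refine ⟨⟨fun v α => B.symp.isPoisson.alt _ _, hsmooth, ?_⟩, B.contMDiff_proj, ?_⟩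
  · intro f g h hf hg hh v
    obtain ⟨a, rfl⟩ := B.proj_surjective v
    have key : ∀ {f g h : V → ℝ}, ContMDiff 𝓘(ℝ, EV) 𝓘(ℝ, ℝ) ∞ f →
        ContMDiff 𝓘(ℝ, EV) 𝓘(ℝ, ℝ) ∞ g → ContMDiff 𝓘(ℝ, EV) 𝓘(ℝ, ℝ) ∞ h →
        B.inducedPoisson.bracket f (B.inducedPoisson.bracket g h) (B.proj a) =
          B.symp.poisson.bracket (f ∘ B.proj)
            (B.symp.poisson.bracket (g ∘ B.proj) (h ∘ B.proj)) a := fun hf hg hh => by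
      rw [← B.bracket_inducedPoisson_proj hg hh,
        ← B.bracket_inducedPoisson_proj hf (hsmooth _ _ hg hh), Function.comp_apply]
    rw [key hf hg hh, key hg hh hf, key hh hf hg]
    exact B.symp.isPoisson.jacobi _ _ _ (hf.comp B.contMDiff_proj) (hg.comp B.contMDiff_proj)
      (hh.comp B.contMDiff_proj) a
  · intro f g hf hg a
    rw [← B.bracket_inducedPoisson_proj hf hg, Function.comp_apply]

variable [FiniteDimensional ℝ EV] [T2Space V] [IsManifold 𝓘(ℝ, EV) ∞ V]

/-- The Poisson-map condition constrains only differentials of global functions, but these exhaust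
the covectors. This is what forces uniqueness. -/
theorem IsInducedPoisson.apply_proj {B : SymplecticRBundle EA EV A V} {Λ : Bivector EV V}
    (hΛ : IsInducedPoisson B Λ) (a : A) (α β : Cotangent EV (B.proj a)) :
    Λ (B.proj a) α β = B.symp.poisson a ((tangent EA EV B.proj a).dualMap α)
      ((tangent EA EV B.proj a).dualMap β) := by
  obtain ⟨f, hf, rfl⟩ := exists_differential_eq (B.proj a) α
  obtain ⟨g, hg, rfl⟩ := exists_differential_eq (B.proj a) β
  rw [← differential_comp (mdifferentiableAt_of_contMDiff hf _) (B.mdifferentiableAt_proj a),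
    ← differential_comp (mdifferentiableAt_of_contMDiff hg _) (B.mdifferentiableAt_proj a)]
  exact (hΛ.2.bracket_comp f g hf hg a).symm

theorem SymplecticRBundle.existsUnique_isInducedPoisson [IsManifold 𝓘(ℝ, EA) ∞ A]
    (B : SymplecticRBundle EA EV A V) : ∃! Λ : Bivector EV V, IsInducedPoisson B Λ := by
  refine ⟨B.inducedPoisson, B.isInducedPoisson, fun Λ hΛ => ?_⟩
  funext v
  obtain ⟨a, rfl⟩ := B.proj_surjective v
  ext α β
  rw [hΛ.apply_proj, B.inducedPoisson_proj]

end Induced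

/-! ### The induced map of base spaces -/

section Embedding

theorem baseMap_comp_proj (B : PrincipalRBundle EA EV A V) (B' : PrincipalRBundle EA' EV' A' V')
    {φ : A → A'} (hφ : ∀ s a, φ (B.act s a) = B'.act s (φ a)) :
    baseMap B B' φ ∘ B.proj = B'.proj ∘ φ :=
  funext (baseMap_proj B B' hφ)

theorem contMDiff_baseMap (B : PrincipalRBundle EA EV A V) (B' : PrincipalRBundle EA' EV' A' V')
    {φ : A → A'} (hφ : ∀ s a, φ (B.act s a) = B'.act s (φ a))
    (hs : ContMDiff 𝓘(ℝ, EA) 𝓘(ℝ, EA') ∞ φ) :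
    ContMDiff 𝓘(ℝ, EV) 𝓘(ℝ, EV') ∞ (baseMap B B' φ) := by
  refine B.contMDiff_of_comp_proj ?_
  rw [baseMap_comp_proj B B' hφ]
  exact B'.contMDiff_proj.comp hs

theorem isEmbedding_baseMap (B : PrincipalRBundle EA EV A V) (B' : PrincipalRBundle EA' EV' A' V')
    {φ : A → A'} (hφ : ∀ s a, φ (B.act s a) = B'.act s (φ a)) (he : Topology.IsEmbedding φ)
    (hc : Continuous (baseMap B B' φ)) : Topology.IsEmbedding (baseMap B B' φ) := by
  -- The fibre of `μ'` over a point of the image of `φ^V` is a single orbit meeting `φ(A)`, so by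
  -- equivariance it lies in `φ(A)`.
  have hlift : ∀ a a₁, baseMap B B' φ (B.proj a) = B'.proj a₁ → ∃ s, φ (B.act s a) = a₁ := by
    intro a a₁ h
    rw [baseMap_proj B B' hφ] at h
    obtain ⟨s, hs⟩ := B'.exists_act_eq h
    exact ⟨s, (hφ s a).trans hs⟩
  refine ⟨⟨le_antisymm hc.le_induced ?_⟩, ?_⟩
  · intro W hW
    obtain ⟨U, hU, hUW⟩ := he.isInducing.isOpen_iff.1
      (IsOpen.preimage B.contMDiff_proj.continuous hW)
    -- Here `φ⁻¹(U) = μ⁻¹(W)`. The set `U` need not be invariant: any point of `U` over the image of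
    -- `φ^V` lies in `φ(A)` by `hlift`.
    refine ⟨B'.proj '' U, B'.isOpenMap_proj U hU, ?_⟩
    ext v
    obtain ⟨a, rfl⟩ := B.proj_surjective v
    have hmem : ∀ b, φ b ∈ U ↔ B.proj b ∈ W := fun b => Set.ext_iff.1 hUW b
    constructor
    · rintro ⟨u, hu, hu'⟩
      obtain ⟨s, rfl⟩ := hlift a u hu'.symm
      rw [hmem, B.proj_act] at hu
      exact hu
    · intro h
      exact ⟨φ a, (hmem a).2 h, (baseMap_proj B B' hφ a).symm⟩
  · intro v w h
    obtain ⟨a, rfl⟩ := B.proj_surjective v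
    obtain ⟨b, rfl⟩ := B.proj_surjective w
    obtain ⟨s, hs⟩ := hlift a (φ b) (h.trans (baseMap_proj B B' hφ b))
    rw [← he.injective hs, B.proj_act]

theorem tangent_vertical (B : PrincipalRBundle EA EV A V) (B' : PrincipalRBundle EA' EV' A' V')
    {φ : A → A'} (hφ : ∀ s a, φ (B.act s a) = B'.act s (φ a))
    (hs : ContMDiff 𝓘(ℝ, EA) 𝓘(ℝ, EA') ∞ φ) (a : A) :
    tangent EA EA' φ a (B.vertical a) = B'.vertical (φ a) := by
  unfold PrincipalRBundle.vertical
  rw [tangent_velocity _ (mdifferentiableAt_of_contMDiff hs a)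
    (mdifferentiableAt_of_contMDiff (B.contMDiff_orbit a) 0)]
  exact velocity_congr _ _ (funext fun s => hφ s a)

end Embedding

end Bundles

/-! ### Immersion, splitting and Poisson isomorphism -/

section Main

variable {EA EV A V : Type*}
  [NormedAddCommGroup EA] [NormedSpace ℝ EA] [NormedAddCommGroup EV] [NormedSpace ℝ EV]
  [TopologicalSpace A] [ChartedSpace EA A] [TopologicalSpace V] [ChartedSpace EV V]
  {EA' EV' A' V' : Type*}
  [NormedAddCommGroup EA'] [NormedSpace ℝ EA'] [NormedAddCommGroup EV'] [NormedSpace ℝ EV']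
  [TopologicalSpace A'] [ChartedSpace EA' A'] [TopologicalSpace V'] [ChartedSpace EV' V']

/-- The base point `v` is kept separate because `φ^V(μ(a))` and `μ'(φ(a))` are equal without being
the same expression. -/
theorem IsInducedPoisson.apply_tangentProjTo [FiniteDimensional ℝ EA] [FiniteDimensional ℝ EV]
    [T2Space V] [IsManifold 𝓘(ℝ, EV) ∞ V] {B : SymplecticRBundle EA EV A V} {Λ : Bivector EV V}
    (hΛ : IsInducedPoisson B Λ) {v : V} {a : A} (h : B.proj a = v) (α β : Cotangent EV v) :
    Λ v α β = B.symp.poisson a ((B.tangentProjTo v a).dualMap α)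
      ((B.tangentProjTo v a).dualMap β) := by
  subst h
  exact hΛ.apply_proj a α β

theorem tangent_baseMap_comp (B : PrincipalRBundle EA EV A V)
    (B' : PrincipalRBundle EA' EV' A' V') {φ : A → A'}
    (hφ : ∀ s a, φ (B.act s a) = B'.act s (φ a)) (hs : ContMDiff 𝓘(ℝ, EA) 𝓘(ℝ, EA') ∞ φ) (a : A) :
    tangent EV EV' (baseMap B B' φ) (B.proj a) ∘ₗ tangent EA EV B.proj a =
      B'.tangentProjTo (baseMap B B' φ (B.proj a)) (φ a) ∘ₗ tangent EA EA' φ a := by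
  have heq : ∀ k : A → V', k = B'.proj ∘ φ →
      (tangent EA EV' k a : EA →ₗ[ℝ] EV') = tangent EA EV' (B'.proj ∘ φ) a := by
    rintro _ rfl
    rfl
  have hT := heq _ (baseMap_comp_proj B B' hφ)
  rw [tangent_comp (mdifferentiableAt_of_contMDiff (contMDiff_baseMap B B' hφ hs) _)
    (B.mdifferentiableAt_proj a), tangent_comp (B'.mdifferentiableAt_proj _)
    (mdifferentiableAt_of_contMDiff hs a)] at hT
  exact hT

/-- The vertical line of `A'` at `φ(a)` is the image of the one at `a`. This is the kernel condition
of `IsDualForm.splitting`. -/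
theorem tangentProjTo_ker_le (B : PrincipalRBundle EA EV A V)
    (B' : PrincipalRBundle EA' EV' A' V') {φ : A → A'}
    (hφ : ∀ s a, φ (B.act s a) = B'.act s (φ a)) (hs : ContMDiff 𝓘(ℝ, EA) 𝓘(ℝ, EA') ∞ φ) (a : A)
    (v : V') : LinearMap.ker (B'.tangentProjTo v (φ a)) ≤
      LinearMap.range (tangent EA EA' φ a) := by
  intro w hw
  obtain ⟨r, rfl⟩ := B'.exists_eq_smul_vertical (a := φ a) (w := w) hw
  exact ⟨r • B.vertical a, by rw [map_smul, tangent_vertical B B' hφ hs]⟩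

theorem isManifoldEmbedding_baseMap (B : PrincipalRBundle EA EV A V)
    (B' : PrincipalRBundle EA' EV' A' V') {φ : A → A'}
    (hφ : ∀ s a, φ (B.act s a) = B'.act s (φ a)) (he : IsManifoldEmbedding EA EA' φ) :
    IsManifoldEmbedding EV EV' (baseMap B B' φ) where
  contMDiff := contMDiff_baseMap B B' hφ he.contMDiff
  isEmbedding := isEmbedding_baseMap B B' hφ he.isEmbedding
    (contMDiff_baseMap B B' hφ he.contMDiff).continuous
  tangent_injective v := by
    obtain ⟨a, rfl⟩ := B.proj_surjective v
    refine (injective_iff_map_eq_zero _).2 fun u hu => ?_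
    -- If `Tφ^V` kills `Tμ w`, then `Tφ w` is vertical, so it equals `Tφ` of a vertical vector;
    -- injectivity of `Tφ` makes `w` vertical.
    obtain ⟨w, rfl⟩ := B.tangent_proj_surjective a u
    have h := LinearMap.congr_fun (tangent_baseMap_comp B B' hφ he.contMDiff a) w
    rw [LinearMap.comp_apply, LinearMap.comp_apply, hu] at h
    obtain ⟨r, hr⟩ := B'.exists_eq_smul_vertical (w := tangent EA EA' φ a w) h.symm
    rw [← tangent_vertical B B' hφ he.contMDiff, ← map_smul] at hr
    rw [he.tangent_injective a hr, map_smul, B.tangent_proj_vertical, smul_zero]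

/-- Evaluating `σ` on `♯γ` gives `Λ'(γ, σ)`, so the double annihilator is the `Λ'`-orthogonal of the
conormal space, as the linear algebra requires. -/
theorem mem_coconormal_iff [FiniteDimensional ℝ EV'] (Λ' : Bivector EV' V') (k : V → V') (v : V)
    (σ : Cotangent EV' (k v)) :
    σ ∈ coconormal EV Λ' k v ↔ ∀ γ ∈ conormal EV EV' k v, Λ' (k v) γ σ = 0 := by
  have h : ∀ γ, σ (Λ'.sharp (k v) γ) = Λ' (k v) γ σ := fun γ =>
    Module.apply_evalEquiv_symm_apply ℝ (TangentSpace 𝓘(ℝ, EV') (k v)) σ (Λ' (k v) γ)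
  rw [coconormal, Submodule.mem_dualAnnihilator]
  constructor
  · intro hσ γ hγ
    rw [← h]
    exact hσ _ ⟨γ, hγ, rfl⟩
  · rintro hσ _ ⟨γ, hγ, rfl⟩
    rw [h]
    exact hσ γ hγ

variable [FiniteDimensional ℝ EA] [FiniteDimensional ℝ EV] [T2Space V] [IsManifold 𝓘(ℝ, EV) ∞ V]
  [FiniteDimensional ℝ EA'] [FiniteDimensional ℝ EV'] [T2Space V'] [IsManifold 𝓘(ℝ, EV') ∞ V']
  {B : SymplecticRBundle EA EV A V} {B' : SymplecticRBundle EA' EV' A' V'} {φ : A → A'}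
  {Λ : Bivector EV V} {Λ' : Bivector EV' V'}

/-- Both bivectors are evaluated upstairs, at `a` and `φ(a)`, where `Tφ` is a surjective symplectic
map and hence respects the dual forms. -/
theorem isPoissonMap_baseMap (hφ : ∀ s a, φ (B.act s a) = B'.act s (φ a))
    (hs : ContMDiff 𝓘(ℝ, EA) 𝓘(ℝ, EA') ∞ φ)
    (hsurj : ∀ a, Function.Surjective (tangent EA EA' φ a))
    (hpull : ∀ a, pullbackForm φ B'.symp.form a = B.symp.form a)
    (hΛ : IsInducedPoisson B Λ) (hΛ' : IsInducedPoisson B' Λ') :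
    IsPoissonMap Λ Λ' (baseMap B.toPrincipalRBundle B'.toPrincipalRBundle φ) where
  contMDiff := contMDiff_baseMap _ _ hφ hs
  bracket_comp f g hf hg v := by
    obtain ⟨a, rfl⟩ := B.proj_surjective v
    have hb := mdifferentiableAt_of_contMDiff
      (contMDiff_baseMap B.toPrincipalRBundle B'.toPrincipalRBundle hφ hs) (B.proj a)
    rw [Bivector.bracket, Bivector.bracket,
      differential_comp (mdifferentiableAt_of_contMDiff hf _) hb,
      differential_comp (mdifferentiableAt_of_contMDiff hg _) hb, hΛ.apply_proj,
      hΛ'.apply_tangentProjTo (a := φ a) (baseMap_proj _ _ hφ a).symm,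
      ← (B.symp.isDualForm a).apply_dualMap (B'.symp.isDualForm (φ a)) (hsurj a)
        (bilin_tangent_of_pullbackForm_eq (hpull a))]
    have key : ∀ γ, (tangent EA EV B.proj a).dualMap ((tangent EV EV'
        (baseMap B.toPrincipalRBundle B'.toPrincipalRBundle φ) (B.proj a)).dualMap γ) =
        (tangent EA EA' φ a).dualMap ((B'.tangentProjTo _ (φ a)).dualMap γ) := fun γ =>
      congrArg (fun T => LinearMap.dualMap T γ)
        (tangent_baseMap_comp B.toPrincipalRBundle B'.toPrincipalRBundle hφ hs a)
    rw [key, key]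

theorem isPoissonIso_baseMap (hφ : ∀ s a, φ (B.act s a) = B'.act s (φ a))
    (hpull : ∀ a, pullbackForm φ B'.symp.form a = B.symp.form a)
    (hΛ : IsInducedPoisson B Λ) (hΛ' : IsInducedPoisson B' Λ')
    (hΦ : ∃ Φ : Diffeomorph 𝓘(ℝ, EA) 𝓘(ℝ, EA') A A' ∞, ⇑Φ = φ) :
    IsPoissonIso Λ Λ' (baseMap B.toPrincipalRBundle B'.toPrincipalRBundle φ) := by
  obtain ⟨Φ, rfl⟩ := hΦ
  have hsymm : ∀ s a, Φ.symm (B'.act s a) = B.act s (Φ.symm a) := fun s a => by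
    apply Φ.injective
    change Φ _ = Φ _
    rw [hφ, Φ.apply_symm_apply, Φ.apply_symm_apply]
  have hpoisson := isPoissonMap_baseMap hφ Φ.contMDiff
    (fun a => (Φ.mfderivToContinuousLinearEquiv (by simp) a).surjective) hpull hΛ hΛ'
  have hinv := contMDiff_baseMap B'.toPrincipalRBundle B.toPrincipalRBundle hsymm
    Φ.symm.contMDiff
  have hl : ∀ v, baseMap B'.toPrincipalRBundle B.toPrincipalRBundle Φ.symm
      (baseMap B.toPrincipalRBundle B'.toPrincipalRBundle Φ v) = v := fun v => by
    obtain ⟨a, rfl⟩ := B.proj_surjective v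
    rw [baseMap_proj _ _ hφ, baseMap_proj _ _ hsymm, Φ.symm_apply_apply]
  have hr : ∀ v, baseMap B.toPrincipalRBundle B'.toPrincipalRBundle Φ
      (baseMap B'.toPrincipalRBundle B.toPrincipalRBundle Φ.symm v) = v := fun v => by
    obtain ⟨a, rfl⟩ := B'.proj_surjective v
    rw [baseMap_proj _ _ hsymm, baseMap_proj _ _ hφ, Φ.apply_symm_apply]
  refine ⟨⟨⟨_, _, hl, hr⟩, hpoisson.contMDiff, hinv⟩, rfl, hpoisson, hinv, ?_⟩
  intro f g hf hg v
  -- The inverse is Poisson: the property of `φ^V` is applied to `f` and `g` composed with the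
  -- inverse, at the inverse image of `v`.
  have h := hpoisson.bracket_comp _ _ (hf.comp hinv) (hg.comp hinv)
    (baseMap B'.toPrincipalRBundle B.toPrincipalRBundle Φ.symm v)
  have hid : ∀ k : V → ℝ, (k ∘ baseMap B'.toPrincipalRBundle B.toPrincipalRBundle Φ.symm) ∘
      baseMap B.toPrincipalRBundle B'.toPrincipalRBundle Φ = k := fun k =>
    funext fun w => congrArg k (hl w)
  rw [hid, hid, hr] at h
  exact h.symm

theorem IsSymplecticRBundleEmbedding.splitting (hφ : IsSymplecticRBundleEmbedding B B' φ)
    (hΛ : IsInducedPoisson B Λ) (hΛ' : IsInducedPoisson B' Λ') (v : V) :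
    ∃ h : IsCompl
        (conormal EV EV' (baseMap B.toPrincipalRBundle B'.toPrincipalRBundle φ) v)
        (coconormal EV Λ' (baseMap B.toPrincipalRBundle B'.toPrincipalRBundle φ) v),
      ∀ σ₁ σ₂ : Cotangent EV' (baseMap B.toPrincipalRBundle B'.toPrincipalRBundle φ v),
        Λ v
            ((tangent EV EV' (baseMap B.toPrincipalRBundle B'.toPrincipalRBundle φ) v).dualMap σ₁)
            ((tangent EV EV' (baseMap B.toPrincipalRBundle B'.toPrincipalRBundle φ) v).dualMap σ₂) =
          Λ' (baseMap B.toPrincipalRBundle B'.toPrincipalRBundle φ v) σ₁ σ₂ -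
            Λ' (baseMap B.toPrincipalRBundle B'.toPrincipalRBundle φ v)
              (Submodule.projection _ _ h σ₁) (Submodule.projection _ _ h σ₂) := by
  obtain ⟨a, rfl⟩ := B.proj_surjective v
  have hs := hφ.isManifoldEmbedding.contMDiff
  have hb := baseMap_proj B.toPrincipalRBundle B'.toPrincipalRBundle hφ.equivariant a
  have hτ := tangent_baseMap_comp B.toPrincipalRBundle B'.toPrincipalRBundle hφ.equivariant hs a
  -- Only the base-point equation `hb` and the tangent square `hτ` matter from here on.
  generalize baseMap B.toPrincipalRBundle B'.toPrincipalRBundle φ = φV at hb hτ ⊢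
  have hsurj : Function.Surjective (B'.tangentProjTo (φV (B.proj a)) (φ a)) :=
    B'.tangent_proj_surjective (φ a)
  have hker := tangentProjTo_ker_le B.toPrincipalRBundle B'.toPrincipalRBundle hφ.equivariant hs a
    (φV (B.proj a))
  exact (B.symp.isDualForm a).splitting (B'.symp.isDualForm (φ a)) (B'.symp.bilin_skew (φ a))
    (B.tangent_proj_surjective a) hsurj hτ
    (bilin_tangent_of_pullbackForm_eq (hφ.pullback a)) hker
    (hΛ.apply_proj a) (hΛ'.apply_tangentProjTo hb.symm) rfl (mem_coconormal_iff Λ' _ _)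

end Main

end SymplecticR

end

theorem proposition3p6
    {EA EV A V : Type*}
    [NormedAddCommGroup EA] [NormedSpace ℝ EA] [FiniteDimensional ℝ EA]
    [NormedAddCommGroup EV] [NormedSpace ℝ EV] [FiniteDimensional ℝ EV]
    [TopologicalSpace A] [T2Space A] [ChartedSpace EA A] [IsManifold 𝓘(ℝ, EA) ∞ A]
    [TopologicalSpace V] [T2Space V] [ChartedSpace EV V] [IsManifold 𝓘(ℝ, EV) ∞ V]
    {EA' EV' A' V' : Type*}
    [NormedAddCommGroup EA'] [NormedSpace ℝ EA'] [FiniteDimensional ℝ EA']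
    [NormedAddCommGroup EV'] [NormedSpace ℝ EV'] [FiniteDimensional ℝ EV']
    [TopologicalSpace A'] [T2Space A'] [ChartedSpace EA' A'] [IsManifold 𝓘(ℝ, EA') ∞ A']
    [TopologicalSpace V'] [T2Space V'] [ChartedSpace EV' V'] [IsManifold 𝓘(ℝ, EV') ∞ V']
    (B : SymplecticR.SymplecticRBundle EA EV A V)
    (B' : SymplecticR.SymplecticRBundle EA' EV' A' V')
    (φ : A → A') (hφ : SymplecticR.IsSymplecticRBundleEmbedding B B' φ) :
    -- each base space carries a unique Poisson structure for which the projection is Poisson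
    (∃! Λ : SymplecticR.Bivector EV V, SymplecticR.IsInducedPoisson B Λ) ∧
    (∃! Λ' : SymplecticR.Bivector EV' V', SymplecticR.IsInducedPoisson B' Λ') ∧
    ∀ (φV : V → V') (_ : φV = SymplecticR.baseMap B.toPrincipalRBundle B'.toPrincipalRBundle φ)
      (Λ : SymplecticR.Bivector EV V) (_ : SymplecticR.IsInducedPoisson B Λ)
      (Λ' : SymplecticR.Bivector EV' V') (_ : SymplecticR.IsInducedPoisson B' Λ'),
      SymplecticR.IsManifoldEmbedding EV EV' φV ∧
      (∀ v : V,
        ∃ h : IsCompl (SymplecticR.conormal EV EV' φV v) (SymplecticR.coconormal EV Λ' φV v),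
        ∀ σ₁ σ₂ : SymplecticR.Cotangent EV' (φV v),
          Λ v ((SymplecticR.tangent EV EV' φV v).dualMap σ₁)
              ((SymplecticR.tangent EV EV' φV v).dualMap σ₂) =
            Λ' (φV v) σ₁ σ₂ -
              Λ' (φV v) (Submodule.projection _ _ h σ₁) (Submodule.projection _ _ h σ₂)) ∧
      ((∃ Φ : Diffeomorph 𝓘(ℝ, EA) 𝓘(ℝ, EA') A A' ∞, ⇑Φ = φ) →
        SymplecticR.IsPoissonIso Λ Λ' φV) := by
  refine ⟨B.existsUnique_isInducedPoisson, B'.existsUnique_isInducedPoisson, ?_⟩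
  rintro _ rfl Λ hΛ Λ' hΛ'
  exact ⟨SymplecticR.isManifoldEmbedding_baseMap _ _ hφ.equivariant hφ.isManifoldEmbedding,
    hφ.splitting hΛ hΛ', SymplecticR.isPoissonIso_baseMap hφ.equivariant hφ.pullback hΛ hΛ'⟩
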